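/- Let $s, m\in\mathbb N$, let $-\infty<a_i<b_i<\infty$ for $i\in[s]:=\{1,\dots,s\}$, and let $\gamma_{\mathfrak u}>0$ for $\mathfrak u\subseteq[s]$. Let $f\in\mathbb F_2[x]$ be irreducible with $\deg f=m$, and let $G_m=\{h\in\mathbb F_2[x]:\deg h<m\}$. **Polynomial lattice point sets.** For a formal Laurent series $g=\sum_k a_kx^{-k}\in\mathbb F_2((x^{-1}))$ put $\{g\}_m=\sum_{k=1}^m a_k2^{-k}$ (digits $0,1$). For $\boldsymbol g\in\mathbb F_2[x]^d$, $\mathcal P(\boldsymbol g,f)$ consists of the $2^m$ points $\boldsymbol y_h=(\{hg_1/f\}_m,\dots,\{hg_d/f\}_m)$, $h\in G_m$ (counted with multiplicity). **Figure of merit.** For $k\in\mathbb N_0$ let $\mu(k)$ be its number of binary digits ($\mu(0)=0$). If $k=\sum_{j\ge0}\kappa_j2^j$ and $y=\sum_{j\ge1}\xi_j2^{-j}\in[0,1)$ are the binary expansions (infinitely many $\xi_j$ equal to $0$), let $\mathrm{wal}_k(y)=(-1)^{\kappa_0\xi_1+\kappa_1\xi_2+\cdots}$. For $d\in[s]$ and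 $\boldsymbol g\in G_m^d$ set $$B_{\boldsymbol\gamma}(\boldsymbol g,f)=\sum_{\emptyset\ne\mathfrak u\subseteq[d]}\gamma_{\mathfrak u}\prod_{i\in\mathfrak u}(b_i-a_i)\sum_{\boldsymbol k\in\{1,\dots,2^m-1\}^{\mathfrak u}}2^{-\sum_{i\in\mathfrak u}\mu(k_i)}\left|\frac1{2^m}\sum_{h\in G_m}\prod_{i\in\mathfrak u}\mathrm{wal}_{k_i}(y_{h,i})\right| .$$ **Construction.** Let $\boldsymbol g^*=(g_1^*,\dots,g_s^*)\in G_m^s$ be any vector obtained component by component: $g_1^*=1$ and, for $d=2,\dots,s$, $g_d^*$ minimizes $g\mapsto B_{\boldsymbol\gamma}((g_1^*,\dots,g_{d-1}^*,g),f)$ over $g\in G_m$. **Worst-case error.** Let $d\in[s]$, $[\boldsymbol a,\boldsymbol b]=\prod_{i=1}^d[a_i,b_i]$, and $\varphi(\boldsymbol x)=\prod_{i=1}^d\varphi_i(x_i)$, where each $\varphi_i$ is a probability density on $[a_i,b_i]$ such that $\Phi_i(x)=\int_{a_i}^x\varphi_i(y)\,\mathrm dy$ is invertible as a map $[a_i,b_i]\to[0,1]$;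 let $\Phi^{-1}=(\Phi_1^{-1},\dots,\Phi_d^{-1})$. For $F:[\boldsymbol a,\boldsymbol b]\to\mathbb R$ all of whose mixed partial derivatives $\partial^{|\mathfrak u|}F/\partial\boldsymbol x_{\mathfrak u}=\partial^kF/\partial x_{u_1}\cdots\partial x_{u_k}$, $\mathfrak u=\{u_1<\dots<u_k\}\subseteq[d]$, exist on $[\boldsymbol a,\boldsymbol b]$ (one-sided at the faces), let $$\|F\|_{\infty,d,\boldsymbol\gamma}=\max_{\mathfrak u\subseteq[d]}\frac1{\gamma_{\mathfrak u}}\sup_{\boldsymbol x\in[\boldsymbol a,\boldsymbol b]}\left|\frac{\partial^{|\mathfrak u|}F}{\partial\boldsymbol x_{\mathfrak u}}(\boldsymbol x)\right| ,$$ and for $\mathcal P=\{\boldsymbol y_0,\dots,\boldsymbol y_{N-1}\}\subset[0,1]^d$ let $$\mathrm{wce}(\mathcal P;\infty,d,\boldsymbol\gamma,\varphi)=\sup_{\|F\|_{\infty,d,\boldsymbol\gamma}\le1}\left|\frac1N\sum_{n=0}^{N-1}F(\Phi^{-1}(\boldsymbol y_n))-\int_{[\boldsymbol a,\boldsymbol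 b]}F(\boldsymbol x)\varphi(\boldsymbol x)\,\mathrm d\boldsymbol x\right| .$$ **Claim.** For every $d\in[s]$ and every such product density $\varphi$, $$\mathrm{wce}(\mathcal P((g_1^*,\dots,g_d^*),f);\infty,d,\boldsymbol\gamma,\varphi)\le\frac1{2^m}\sum_{\emptyset\ne\mathfrak u\subseteq[d]}\gamma_{\mathfrak u}\left(2^{|\mathfrak u|}+\left(\frac m2\right)^{|\mathfrak u|}\right)\prod_{i\in\mathfrak u}(b_i-a_i).$$ -/

import Mathlib

open MeasureTheory Polynomial
open scoped ENNReal

noncomputable section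

namespace WeightedQMC

/-! ### Product densities on a cube and their inverse distribution functions -/

/-- The cumulative distribution function `x ↦ ∫_{a}^{x} φ(y) dy`. -/
def cdf (a : ℝ) (φ : ℝ → ℝ) (x : ℝ) : ℝ := ∫ y in a..x, φ y

/-- `φ` is a probability density function on `[a, b]` (with respect to the Lebesgue measure)
whose cumulative distribution function is an invertible map `[a, b] → [0, 1]`. -/
structure IsInvertiblePDF (a b : ℝ) (φ : ℝ → ℝ) : Prop where
  nonneg : ∀ x ∈ Set.Icc a b, 0 ≤ φ x
  integrable : IntegrableOn φ (Set.Icc a b)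
  integral_eq_one : ∫ y in a..b, φ y = 1
  bijOn_cdf : Set.BijOn (cdf a φ) (Set.Icc a b) (Set.Icc 0 1)

/-- The inverse `Φ⁻¹ : [0, 1] → [a, b]` of the cumulative distribution function. -/
def invCdf (a b : ℝ) (φ : ℝ → ℝ) : ℝ → ℝ := Function.invFunOn (cdf a φ) (Set.Icc a b)

/-! ### Mixed partial derivatives and the weighted norm

A function `F : [a, b] → ℝ` is represented by a function on all of `Fin s → ℝ`; everything below
depends only on its values on the cube `Set.Icc a b`. -/

/-- The partial derivative in coordinate `i`, one-sided at the two faces of the cube. -/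
def partialDeriv {s : ℕ} (a b : Fin s → ℝ) (i : Fin s) (F : (Fin s → ℝ) → ℝ) :
    (Fin s → ℝ) → ℝ :=
  fun x => derivWithin (fun t => F (Function.update x i t)) (Set.Icc (a i) (b i)) (x i)

/-- `∂^k F / ∂x_{u_1} ⋯ ∂x_{u_k}` for `u = {u_1 < ⋯ < u_k}`. -/
def mixedPartial {s : ℕ} (a b : Fin s → ℝ) (u : Finset (Fin s)) (F : (Fin s → ℝ) → ℝ) :
    (Fin s → ℝ) → ℝ :=
  (u.sort (· ≤ ·)).foldr (fun i G => partialDeriv a b i G) F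

/-- All the mixed partial derivatives `∂^{|u|} F / ∂x_u` exist at every point of the cube: if `i`
precedes all the elements of `u`, then `∂^{|u|} F / ∂x_u` is differentiable in coordinate `i`. -/
def HasMixedPartials {s : ℕ} (a b : Fin s → ℝ) (F : (Fin s → ℝ) → ℝ) : Prop :=
  ∀ (u : Finset (Fin s)) (i : Fin s), (∀ j ∈ u, i < j) → ∀ x ∈ Set.Icc a b,
    DifferentiableWithinAt ℝ (fun t => mixedPartial a b u F (Function.update x i t))
      (Set.Icc (a i) (b i)) (x i)

/-- `(1 / γ_u) sup_{x ∈ [a, b]} |∂^{|u|} F / ∂x_u (x)|`, possibly infinite. -/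
def normTerm {s : ℕ} (a b : Fin s → ℝ) (γ : Finset (Fin s) → ℝ) (F : (Fin s → ℝ) → ℝ)
    (u : Finset (Fin s)) : ℝ≥0∞ :=
  (ENNReal.ofReal (γ u))⁻¹ * ⨆ x ∈ Set.Icc a b, ENNReal.ofReal |mixedPartial a b u F x|

/-- The weighted norm `‖F‖_{p, s, γ}`, `1 ≤ p ≤ ∞`: the `ℓ_p` norm of the family `normTerm`. -/
def weightedNorm {s : ℕ} (p : ℝ≥0∞) (a b : Fin s → ℝ) (γ : Finset (Fin s) → ℝ)
    (F : (Fin s → ℝ) → ℝ) : ℝ≥0∞ :=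
  if p = ∞ then ⨆ u : Finset (Fin s), normTerm a b γ F u
  else (∑ u : Finset (Fin s), normTerm a b γ F u ^ p.toReal) ^ (1 / p.toReal)

/-! ### The integration error -/

/-- `err(F; φ; P)` for the nodes `P = (y_n)_{n ∈ ι}` in `[0, 1]^s` and `φ(x) = ∏ i, φ_i(x_i)`. -/
def integrationError {s : ℕ} {ι : Type} [Fintype ι] (P : ι → Fin s → ℝ) (a b : Fin s → ℝ)
    (φ : Fin s → ℝ → ℝ) (F : (Fin s → ℝ) → ℝ) : ℝ :=
  (1 / (Fintype.card ι : ℝ)) * ∑ n : ι, F (fun i => invCdf (a i) (b i) (φ i) (P n i))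
    - ∫ x in Set.Icc a b, F x * ∏ i : Fin s, φ i (x i)

/-- The worst-case error `wce(P; p, s, γ, φ)`, the supremum of `|err(F; φ; P)|` over the functions
with `‖F‖_{p, s, γ} ≤ 1`, as an extended nonnegative real. -/
def wce {s : ℕ} {ι : Type} [Fintype ι] (P : ι → Fin s → ℝ) (p : ℝ≥0∞) (a b : Fin s → ℝ)
    (γ : Finset (Fin s) → ℝ) (φ : Fin s → ℝ → ℝ) : ℝ≥0∞ :=
  ⨆ (F : (Fin s → ℝ) → ℝ) (_ : HasMixedPartials a b F) (_ : weightedNorm p a b γ F ≤ 1),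
    ENNReal.ofReal |integrationError P a b φ F|

/-! ### Polynomial lattice point sets -/

/-- The embedding of `𝔽₂[x]` into the field `𝔽₂((x⁻¹))` of formal Laurent series in `x⁻¹`. For an
element `g` of the latter, `g.coeff k` is the coefficient of `x^{-k}`. -/
def laurentOfPoly (p : (ZMod 2)[X]) : LaurentSeries (ZMod 2) :=
  Polynomial.aeval (HahnSeries.single (-1 : ℤ) (1 : ZMod 2)) p

/-- The truncated fractional part `{g}_m = ∑_{k=1}^m a_k 2^{-k}` of `g = ∑_k a_k x^{-k}`. -/
def fracPart (m : ℕ) (g : LaurentSeries (ZMod 2)) : ℝ :=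
  ∑ k ∈ Finset.Icc 1 m, ((g.coeff (k : ℤ)).val : ℝ) / 2 ^ k

/-- The finite set `G_m = {h ∈ 𝔽₂[x] : deg h < m}`. -/
abbrev Gpoly (m : ℕ) : Type := Polynomial.degreeLT (ZMod 2) m

instance instFintypeGpoly (m : ℕ) : Fintype (Gpoly m) :=
  Fintype.ofEquiv (Fin m → ZMod 2) (Polynomial.degreeLTEquiv (ZMod 2) m).symm.toEquiv

/-- The polynomial lattice point set `P(g, f)`, `deg f = m`, as the family of the points
`x_h = ({h g_1 / f}_m, …, {h g_s / f}_m)`, where `h` runs through `G_m`. -/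
def polyLattice {s : ℕ} (m : ℕ) (g : Fin s → (ZMod 2)[X]) (f : (ZMod 2)[X]) :
    Gpoly m → Fin s → ℝ :=
  fun h i => fracPart m (laurentOfPoly ((h : (ZMod 2)[X]) * g i) / laurentOfPoly f)

/-! ### Walsh functions and the figure of merit -/

/-- The `k`-th dyadic Walsh function on `[0, 1)`: `(-1)^{κ_0 ξ_1 + κ_1 ξ_2 + ⋯}`, where `κ_j` are
the binary digits of `k` and `ξ_j = ⌊2^j x⌋ mod 2` those of `x`. -/
def wal (k : ℕ) (x : ℝ) : ℝ :=
  (-1) ^ (∑ j ∈ Finset.range (Nat.size k), (k / 2 ^ j % 2) * (⌊(2 : ℝ) ^ (j + 1) * x⌋₊ % 2))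

/-- `E(P, u) = ∑_{k_u ∈ {1, …, 2^m - 1}^u} 2^{-μ(k_u)} |2^{-m} ∑_n wal_{k_u}(y_{n, u})|`; here
`μ(k)`, the number of binary digits of `k`, is `Nat.size k`. -/
def walshSum {s : ℕ} {ι : Type} [Fintype ι] (m : ℕ) (P : ι → Fin s → ℝ)
    (u : Finset (Fin s)) : ℝ :=
  ∑ k ∈ Fintype.piFinset (fun _ : {i // i ∈ u} => Finset.Icc 1 (2 ^ m - 1)),
    (1 / 2 ^ (∑ i, Nat.size (k i)) : ℝ) *
      |(1 / 2 ^ m : ℝ) * ∑ n : ι, ∏ i, wal (k i) (P n (i : Fin s))|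

/-- The figure of merit
`B_γ(g, f) = ∑_{∅ ≠ u ⊆ [s]} γ_u (∏_{i ∈ u} (b_i - a_i)) E(P(g, f), u)`. -/
def figureOfMerit {s : ℕ} (m : ℕ) (a b : Fin s → ℝ) (γ : Finset (Fin s) → ℝ)
    (g : Fin s → (ZMod 2)[X]) (f : (ZMod 2)[X]) : ℝ :=
  ∑ u ∈ (Finset.univ : Finset (Finset (Fin s))).filter (fun u => u.Nonempty),
    γ u * (∏ i ∈ u, (b i - a i)) * walshSum m (polyLattice m g f) u

/-! ### The component-by-component construction -/

/-- The first `d` components of a vector with `s` components. -/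
def initVec {α : Type} {d s : ℕ} (h : d ≤ s) (v : Fin s → α) : Fin d → α :=
  fun i => v (Fin.castLE h i)

/-- The weights `γ_u` with `u ⊆ [d] ⊆ [s]`. -/
def initWeights {d s : ℕ} (h : d ≤ s) (γ : Finset (Fin s) → ℝ) : Finset (Fin d) → ℝ :=
  fun u => γ (u.map (Fin.castLEEmb h))

/-- `g ∈ G_m^s` is a possible output of the component-by-component algorithm: `g_1 = 1` and, for
each `d` with `1 ≤ d < s`, the component `g_{d+1}` minimizes `B_γ((g_1, …, g_d, h), f)` over all
`h ∈ G_m`. -/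
structure IsCBC {s : ℕ} (m : ℕ) (a b : Fin s → ℝ) (γ : Finset (Fin s) → ℝ)
    (f : (ZMod 2)[X]) (g : Fin s → (ZMod 2)[X]) : Prop where
  mem : ∀ i, g i ∈ Polynomial.degreeLT (ZMod 2) m
  first : ∀ i : Fin s, (i : ℕ) = 0 → g i = 1
  minimal : ∀ (d : ℕ) (hd : d + 1 ≤ s), 1 ≤ d → ∀ h ∈ Polynomial.degreeLT (ZMod 2) m,
    figureOfMerit m (initVec hd a) (initVec hd b) (initWeights hd γ) (initVec hd g) f ≤
      figureOfMerit m (initVec hd a) (initVec hd b) (initWeights hd γ)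
        (Fin.snoc (α := fun _ => (ZMod 2)[X]) (initVec (Nat.le_of_succ_le hd) g) h) f

end WeightedQMC

end

open WeightedQMC

/-! All nodes lie on the dyadic grid of the points `t / 2 ^ m`, so the error splits at the average
of `F ∘ Φ⁻¹` over that whole grid.

Grid average against integral (`abs_gridAverage_sub_integral_le`): the `2 ^ m`-quantiles cut the
cube into cells of equal mass, and `F` is Lipschitz with constant `γ {i}` in coordinate `i`. Cell
widths telescope, which leaves `2 ^ (-m) * ∑ i, γ {i} * (b i - a i)`.

Lattice average against grid average (`abs_integrationError_le`): expand `F ∘ Φ⁻¹` on the grid into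
finitely many Walsh functions. The constant term is the grid average. A coefficient with support `u`
is at most `γ u * ∏ i ∈ u, (b i - a i) * 2 ^ (-μ (k i))` (`abs_walshCoeff_le`), so the remaining
terms sum to at most the figure of merit. The mixed derivatives are not assumed continuous, hence no
integral representation of `F` is available. Instead, each coordinate of `u` is treated by summation
by parts and the mean value inequality: Walsh functions have small partial sums
(`partialSum_gridWal`), and the increments of the quantiles sum to at most `b i - a i`. Densities
therefore leave no trace in the bound.

Figure of merit (`IsCBC.sum_walshSum_le`): the Walsh functions at the lattice points are `±1`-valued
characters of `G_m`, whose normalized sums are 0 or 1. As `f` is irreducible, for fixed frequencies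
at most one choice of the last generator makes the product character trivial. Averaging over that
generator gains `2 ^ (-m)`, and `∑ 2 ^ (-μ k) = m / 2` gives `(m / 2) ^ |u|`. The minimizer is no
worse than the average. -/

namespace WeightedQMC

/-! ### Walsh functions on the dyadic grid -/

/-- The value of the `k`-th Walsh function at `t / 2 ^ m`, for `k, t < 2 ^ m`. -/
noncomputable def gridWal (m k t : ℕ) : ℝ :=
  (-1) ^ (∑ j ∈ Finset.range m, (k / 2 ^ j % 2) * (t / 2 ^ (m - 1 - j) % 2))

theorem wal_zero (x : ℝ) : wal 0 x = 1 := by simp [wal]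

theorem wal_div_two_pow {m k : ℕ} (hk : k < 2 ^ m) (t : ℕ) :
    wal k ((t : ℝ) / 2 ^ m) = gridWal m k t := by
  unfold wal gridWal
  congr 1
  have hs : Nat.size k ≤ m := Nat.size_le.2 hk
  rw [← Finset.sum_subset (Finset.range_subset_range.2 hs)]
  · refine Finset.sum_congr rfl fun j hj => ?_
    have hj' : j < m := (Finset.mem_range.1 hj).trans_le hs
    have h : (2 : ℝ) ^ (j + 1) * ((t : ℝ) / 2 ^ m) = (t : ℝ) / ((2 ^ (m - 1 - j) : ℕ) : ℝ) := by
      push_cast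
      rw [mul_div_assoc', div_eq_div_iff (by positivity) (by positivity)]
      have : (2 : ℝ) ^ m = 2 ^ (j + 1) * 2 ^ (m - 1 - j) := by
        rw [← pow_add]; congr 1; omega
      rw [this]; ring
    rw [h, Nat.floor_div_eq_div]
  · intro j _ hj
    have hj' : k < 2 ^ j := Nat.size_le.1 (by simpa using hj)
    simp [Nat.div_eq_of_lt hj']

theorem gridWal_mem (m k t : ℕ) : gridWal m k t = 1 ∨ gridWal m k t = -1 :=
  neg_one_pow_eq_or ℝ _

theorem abs_gridWal (m k t : ℕ) : |gridWal m k t| = 1 := by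
  rcases gridWal_mem m k t with h | h <;> simp [h]

theorem gridWal_zero_left (m t : ℕ) : gridWal m 0 t = 1 := by simp [gridWal]

/-- Refining the grid pairs the new top bit of `k` with the new lowest bit of `t`; this recursion
drives the inductions on `m` below. -/
theorem gridWal_succ (m k t : ℕ) :
    gridWal (m + 1) k t = gridWal m k (t / 2) * (-1) ^ ((k / 2 ^ m % 2) * (t % 2)) := by
  unfold gridWal
  rw [Finset.sum_range_succ, pow_add]
  congr 2
  · refine Finset.sum_congr rfl fun j hj => ?_
    have : m + 1 - 1 - j = (m - 1 - j) + 1 := by have := Finset.mem_range.1 hj; omega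
    rw [this, pow_succ', ← Nat.div_div_eq_div_mul]
  · simp

theorem gridWal_add_two_pow (m k t : ℕ) : gridWal m (k + 2 ^ m) t = gridWal m k t := by
  unfold gridWal
  congr 1
  refine Finset.sum_congr rfl fun j hj => ?_
  have hj := Finset.mem_range.1 hj
  have h : (2 : ℕ) ^ m = 2 ^ j * (2 * 2 ^ (m - 1 - j)) := by
    rw [← pow_succ', ← pow_add]; congr 1; omega
  congr 1
  rw [h, Nat.add_mul_div_left _ _ (by positivity), Nat.add_mul_mod_self_left]

theorem gridWal_succ_of_lt {m k : ℕ} (hk : k < 2 ^ m) (t : ℕ) :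
    gridWal (m + 1) k t = gridWal m k (t / 2) := by
  simp [gridWal_succ, Nat.div_eq_of_lt hk]

theorem gridWal_succ_of_add {m k : ℕ} (hk : k < 2 ^ m) (t : ℕ) :
    gridWal (m + 1) (k + 2 ^ m) t = gridWal m k (t / 2) * (-1) ^ (t % 2) := by
  rw [gridWal_succ, gridWal_add_two_pow]
  simp [Nat.div_eq_of_lt hk]

/-- The Walsh functions form an orthogonal basis of the functions on the dyadic grid. -/
theorem sum_gridWal_mul_gridWal (m : ℕ) : ∀ t t' : ℕ, t < 2 ^ m → t' < 2 ^ m →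
    ∑ k ∈ Finset.range (2 ^ m), gridWal m k t * gridWal m k t' = if t = t' then 2 ^ m else 0 := by
  induction m with
  | zero => intro t t' h h'; simp at h h'; simp [h, h', gridWal]
  | succ m ih =>
    intro t t' h h'
    rw [pow_succ, mul_two, Finset.sum_range_add]
    have h1 : ∀ k ∈ Finset.range (2 ^ m), gridWal (m + 1) k t * gridWal (m + 1) k t' =
        gridWal m k (t / 2) * gridWal m k (t' / 2) := fun k hk => by
      rw [gridWal_succ_of_lt (Finset.mem_range.1 hk), gridWal_succ_of_lt (Finset.mem_range.1 hk)]
    have h2 : ∀ k ∈ Finset.range (2 ^ m),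
        gridWal (m + 1) (2 ^ m + k) t * gridWal (m + 1) (2 ^ m + k) t' =
        gridWal m k (t / 2) * gridWal m k (t' / 2) * ((-1) ^ (t % 2) * (-1) ^ (t' % 2)) :=
      fun k hk => by
        rw [add_comm (2 ^ m) k, gridWal_succ_of_add (Finset.mem_range.1 hk),
          gridWal_succ_of_add (Finset.mem_range.1 hk)]
        ring
    rw [Finset.sum_congr rfl h1, Finset.sum_congr rfl h2, ← Finset.sum_mul,
      ih _ _ (by omega) (by omega)]
    -- The frequencies `k` and `2 ^ m + k` together contribute the factor `1 + (-1) ^ (t + t')`,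
    -- which is 2 or 0 according to whether the lowest bits agree.
    by_cases hd : t / 2 = t' / 2
    · rcases Nat.mod_two_eq_zero_or_one t with ht | ht <;>
        rcases Nat.mod_two_eq_zero_or_one t' with ht' | ht'
      · rw [if_pos hd, if_pos (by omega), ht, ht']; ring
      · rw [if_pos hd, if_neg (by omega), ht, ht']; ring
      · rw [if_pos hd, if_neg (by omega), ht, ht']; ring
      · rw [if_pos hd, if_pos (by omega), ht, ht']; ring
    · rw [if_neg hd, if_neg (by omega)]; ring

theorem sum_range_two_mul (w : ℕ → ℝ) (t : ℕ) :
    ∑ i ∈ Finset.range (2 * t), w i = ∑ i ∈ Finset.range t, (w (2 * i) + w (2 * i + 1)) := by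
  induction t with
  | zero => simp
  | succ t ih => rw [mul_add, mul_one, Finset.sum_range_succ, Finset.sum_range_succ, ih,
      Finset.sum_range_succ]; ring

/-- If the top bit of `k` is unset, the function is constant on the pairs `2 i, 2 i + 1`, so passing
to the finer grid doubles the sums. If it is set, the two values of a pair cancel and only a last
unpaired `±1` survives. -/
theorem partialSum_gridWal (m : ℕ) : ∀ k : ℕ, k < 2 ^ m → 1 ≤ k →
    (∑ t ∈ Finset.range (2 ^ m), gridWal m k t = 0) ∧ ∀ t : ℕ, t ≤ 2 ^ m →
    |∑ i ∈ Finset.range t, gridWal m k i| ≤ 2 ^ m / 2 ^ Nat.size k := by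
  induction m with
  | zero => intro k h1 h2; simp at h1; omega
  | succ m ih =>
    intro k hk hk1
    by_cases hkm : k < 2 ^ m
    · obtain ⟨h0, hb⟩ := ih k hkm hk1
      have he : ∀ t, ∑ i ∈ Finset.range (2 * t), gridWal (m + 1) k i =
          2 * ∑ i ∈ Finset.range t, gridWal m k i := fun t => by
        rw [sum_range_two_mul, Finset.mul_sum]
        refine Finset.sum_congr rfl fun i _ => ?_
        rw [gridWal_succ_of_lt hkm, gridWal_succ_of_lt hkm, Nat.mul_div_cancel_left _ two_pos,
          show (2 * i + 1) / 2 = i by omega]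
        ring
      refine ⟨by rw [pow_succ', he, h0, mul_zero], fun t ht => ?_⟩
      rw [pow_succ', mul_div_assoc]
      rcases Nat.even_or_odd' t with ⟨r, rfl | rfl⟩
      · rw [he, abs_mul, abs_two]
        exact mul_le_mul_of_nonneg_left (hb r (by rw [pow_succ'] at ht; omega)) two_pos.le
      -- With `S` the partial sums on the coarser grid, the first `2 r + 1` terms add up to `S r + S
      -- (r + 1)`.
      · have hr : r + 1 ≤ 2 ^ m := by rw [pow_succ'] at ht; omega
        have hb1 := abs_le.1 (hb r (by omega))
        have hb2 := abs_le.1 (hb (r + 1) hr)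
        rw [Finset.sum_range_succ] at hb2
        rw [Finset.sum_range_succ, he, gridWal_succ_of_lt hkm,
          Nat.mul_div_cancel_left _ two_pos, abs_le]
        constructor <;> linarith
    · obtain ⟨l, rfl⟩ : ∃ l, k = l + 2 ^ m := ⟨k - 2 ^ m, by omega⟩
      have hl : l < 2 ^ m := by rw [pow_succ'] at hk; omega
      have hs : Nat.size (l + 2 ^ m) = m + 1 :=
        le_antisymm (Nat.size_le.2 hk) (Nat.lt_size.2 (by omega))
      have he : ∀ t, ∑ i ∈ Finset.range (2 * t), gridWal (m + 1) (l + 2 ^ m) i = 0 := fun t => by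
        rw [sum_range_two_mul]
        refine Finset.sum_eq_zero fun i _ => ?_
        rw [gridWal_succ_of_add hl, gridWal_succ_of_add hl, Nat.mul_div_cancel_left _ two_pos,
          show (2 * i + 1) / 2 = i by omega, Nat.mul_mod_right, show (2 * i + 1) % 2 = 1 by omega]
        ring
      refine ⟨by rw [pow_succ', he], fun t ht => ?_⟩
      rw [hs, div_self (by positivity)]
      rcases Nat.even_or_odd' t with ⟨r, rfl | rfl⟩
      · simp [he]
      · rw [Finset.sum_range_succ, he, zero_add, abs_gridWal]

theorem sum_gridWal_eq_zero {m k : ℕ} (hk : k < 2 ^ m) (hk1 : 1 ≤ k) :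
    ∑ t ∈ Finset.range (2 ^ m), gridWal m k t = 0 :=
  (partialSum_gridWal m k hk hk1).1

theorem abs_sum_gridWal_le {m k t : ℕ} (hk : k < 2 ^ m) (hk1 : 1 ≤ k) (ht : t ≤ 2 ^ m) :
    |∑ i ∈ Finset.range t, gridWal m k i| ≤ 2 ^ m / 2 ^ Nat.size k :=
  (partialSum_gridWal m k hk hk1).2 t ht

/-- Each block `2 ^ j ≤ k < 2 ^ (j + 1)` has `2 ^ j` elements of size `j + 1` and so contributes `1
/ 2`. -/
theorem sum_inv_two_pow_size (m : ℕ) :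
    ∑ k ∈ Finset.Icc 1 (2 ^ m - 1), (1 / 2 ^ Nat.size k : ℝ) = m / 2 := by
  have hI : ∀ m, Finset.Icc 1 (2 ^ m - 1) = Finset.Ico 1 (2 ^ m) := fun m => by
    ext k; have := Nat.one_le_two_pow (n := m); simp; omega
  rw [hI]
  induction m with
  | zero => simp
  | succ m ih =>
    rw [← Finset.sum_Ico_consecutive _ (Nat.one_le_two_pow (n := m))
      (Nat.pow_le_pow_right two_pos m.le_succ), ih]
    have h : ∀ k ∈ Finset.Ico (2 ^ m) (2 ^ (m + 1)), (1 / 2 ^ Nat.size k : ℝ) = 1 / 2 ^ (m + 1) :=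
      fun k hk => by
        rw [Finset.mem_Ico] at hk
        rw [le_antisymm (Nat.size_le.2 hk.2) (Nat.lt_size.2 hk.1)]
    rw [Finset.sum_congr rfl h, Finset.sum_const, Nat.card_Ico, nsmul_eq_mul,
      Nat.cast_sub (Nat.pow_le_pow_right two_pos m.le_succ)]
    push_cast
    rw [pow_succ]
    field_simp
    ring

/-! ### Binary digits of truncated Laurent series -/

/-- The natural number with binary digits `a 1, …, a m`, most significant digit first. -/
def digitNat (a : ℕ → ℕ) : ℕ → ℕ
  | 0 => 0
  | m + 1 => 2 * digitNat a m + a (m + 1)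

theorem digitNat_lt {a : ℕ → ℕ} (ha : ∀ k, a k < 2) (m : ℕ) : digitNat a m < 2 ^ m := by
  induction m with
  | zero => simp [digitNat]
  | succ m ih => have := ha (m + 1); rw [digitNat, pow_succ]; omega

theorem sum_digits_div_two_pow (a : ℕ → ℕ) (m : ℕ) :
    ∑ k ∈ Finset.Icc 1 m, (a k : ℝ) / 2 ^ k = (digitNat a m : ℝ) / 2 ^ m := by
  induction m with
  | zero => simp [digitNat]
  | succ m ih =>
    rw [Finset.sum_Icc_succ_top (by omega), ih, digitNat]
    push_cast
    field_simp
    ring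

theorem digitNat_div_two_pow {a : ℕ → ℕ} (ha : ∀ k, a k < 2) (m : ℕ) : ∀ j < m,
    digitNat a m / 2 ^ (m - 1 - j) % 2 = a (j + 1) := by
  induction m with
  | zero => intro j hj; omega
  | succ m ih =>
    intro j hj
    have := ha (m + 1)
    rcases Nat.lt_succ_iff_lt_or_eq.1 hj with h | rfl
    · rw [show m + 1 - 1 - j = (m - 1 - j) + 1 by omega, pow_succ', ← Nat.div_div_eq_div_mul,
        digitNat, show (2 * digitNat a m + a (m + 1)) / 2 = digitNat a m by omega, ih j h]
    · simp only [digitNat, Nat.add_sub_cancel, Nat.sub_self, pow_zero, Nat.div_one]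
      omega

theorem gridWal_digitNat {a : ℕ → ℕ} (ha : ∀ k, a k < 2) (m k : ℕ) :
    gridWal m k (digitNat a m) =
      ∏ j ∈ Finset.range m, ((-1 : ℝ) ^ a (j + 1)) ^ (k / 2 ^ j % 2) := by
  rw [gridWal, ← Finset.prod_pow_eq_pow_sum]
  refine Finset.prod_congr rfl fun j hj => ?_
  rw [digitNat_div_two_pow ha m j (Finset.mem_range.1 hj), ← pow_mul, mul_comm]

/-! ### Weighted sums along one coordinate -/

/-- Summation by parts: the boundary term dies because the weights have sum zero, the increments of
`h` are at most `B` times those of `X`, and the latter telescope. -/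
theorem abs_sum_mul_le_of_partialSum_le {a b : ℝ} {h : ℝ → ℝ} {B K : ℝ} {N : ℕ}
    {X w : ℕ → ℝ} (hN : 0 < N) (hd : DifferentiableOn ℝ h (Set.Icc a b))
    (hB : ∀ t ∈ Set.Icc a b, |derivWithin h (Set.Icc a b) t| ≤ B)
    (hX : ∀ t < N, X t ∈ Set.Icc a b) (hmono : ∀ t, t + 1 < N → X t ≤ X (t + 1))
    (hw0 : ∑ t ∈ Finset.range N, w t = 0)
    (hw : ∀ t ≤ N, |∑ i ∈ Finset.range t, w i| ≤ K) :
    |∑ t ∈ Finset.range N, w t * h (X t)| ≤ K * ((b - a) * B) := by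
  have hK : 0 ≤ K := (abs_nonneg _).trans (hw 0 (Nat.zero_le _))
  have hB0 : 0 ≤ B := (abs_nonneg _).trans (hB _ (hX 0 hN))
  have hparts := Finset.sum_range_by_parts (fun t => h (X t)) w N
  simp only [smul_eq_mul, hw0, mul_zero, zero_sub] at hparts
  have hstep : ∀ t ∈ Finset.range (N - 1), |(h (X (t + 1)) - h (X t)) *
      ∑ i ∈ Finset.range (t + 1), w i| ≤ K * (B * (X (t + 1) - X t)) := by
    intro t ht
    have ht' : t + 1 < N := by have := Finset.mem_range.1 ht; omega
    have h1 := (convex_Icc a b).norm_image_sub_le_of_norm_derivWithin_le hd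
      (fun x hx => hB x hx) (hX t (by omega)) (hX (t + 1) ht')
    rw [Real.norm_eq_abs, Real.norm_eq_abs, abs_of_nonneg (sub_nonneg.2 (hmono t ht'))] at h1
    rw [abs_mul, mul_comm]
    exact mul_le_mul (hw _ ht'.le) h1 (abs_nonneg _) hK
  calc |∑ t ∈ Finset.range N, w t * h (X t)|
      = |∑ t ∈ Finset.range (N - 1), (h (X (t + 1)) - h (X t)) *
          ∑ i ∈ Finset.range (t + 1), w i| := by
        rw [← abs_neg (∑ t ∈ Finset.range (N - 1), _), ← hparts]
        simp only [mul_comm]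
    _ ≤ ∑ t ∈ Finset.range (N - 1), K * (B * (X (t + 1) - X t)) :=
        (Finset.abs_sum_le_sum_abs _ _).trans (Finset.sum_le_sum hstep)
    _ = K * (B * (X (N - 1) - X 0)) := by
        rw [← Finset.mul_sum, ← Finset.mul_sum, Finset.sum_range_sub]
    _ ≤ K * ((b - a) * B) := by
        have h1 := (hX 0 hN).1
        have h2 := (hX (N - 1) (by omega)).2
        rw [mul_comm (b - a)]
        gcongr

/-! ### Functions that are differentiable in one coordinate of a cube -/

section Cube

variable {d : ℕ}

/-- `G` is differentiable in coordinate `i` at every point of the cube. -/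
def DiffInCoord (a b : Fin d → ℝ) (i : Fin d) (G : (Fin d → ℝ) → ℝ) : Prop :=
  ∀ x ∈ Set.Icc a b, DifferentiableWithinAt ℝ (fun t => G (Function.update x i t))
    (Set.Icc (a i) (b i)) (x i)

theorem update_mem_Icc {a b x : Fin d → ℝ} (hx : x ∈ Set.Icc a b) {i : Fin d} {t : ℝ}
    (ht : t ∈ Set.Icc (a i) (b i)) : Function.update x i t ∈ Set.Icc a b := by
  constructor
  · intro l
    rcases eq_or_ne l i with rfl | h
    · simpa using ht.1
    · simpa [h] using hx.1 l
  · intro l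
    rcases eq_or_ne l i with rfl | h
    · simpa using ht.2
    · simpa [h] using hx.2 l

theorem piecewise_mem_Icc {a b x y : Fin d → ℝ} (v : Finset (Fin d)) (hx : x ∈ Set.Icc a b)
    (hy : y ∈ Set.Icc a b) : v.piecewise x y ∈ Set.Icc a b :=
  ⟨Finset.le_piecewise_of_le_of_le _ hx.1 hy.1, Finset.piecewise_le_of_le_of_le _ hx.2 hy.2⟩

theorem DiffInCoord.hasDerivWithinAt {a b : Fin d → ℝ} {i : Fin d} {G : (Fin d → ℝ) → ℝ}
    (hG : DiffInCoord a b i G) {x : Fin d → ℝ} (hx : x ∈ Set.Icc a b) {t : ℝ}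
    (ht : t ∈ Set.Icc (a i) (b i)) :
    HasDerivWithinAt (fun t => G (Function.update x i t))
      (partialDeriv a b i G (Function.update x i t)) (Set.Icc (a i) (b i)) t := by
  have h := (hG _ (update_mem_Icc hx ht)).hasDerivWithinAt
  simpa [partialDeriv] using h

/-- The operator which in each coordinate `i ∈ v` replaces `G` by its average over the nodes
`X i 0, …, X i (N - 1)` with the weights `w i 0, …, w i (N - 1)`. -/
noncomputable def gridOp (N : ℕ) (w X : Fin d → ℕ → ℝ) (v : Finset (Fin d))
    (G : (Fin d → ℝ) → ℝ) (x : Fin d → ℝ) : ℝ :=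
  (1 / (N : ℝ) ^ d) * ∑ j : Fin d → Fin N,
    (∏ i ∈ v, w i (j i)) * G (v.piecewise (fun i => X i (j i)) x)

/-- Exchanging `t` with the `i`-th entry of `j` is an involution of the pairs `(t, j)`. -/
theorem sum_sum_update {N : ℕ} (i : Fin d) (φ : (Fin d → Fin N) → ℝ) :
    ∑ t : Fin N, ∑ j : Fin d → Fin N, φ (Function.update j i t) = N * ∑ j, φ j := by
  have hinv : Function.Involutive
      (fun p : Fin N × (Fin d → Fin N) => (p.2 i, Function.update p.2 i p.1)) := by
    rintro ⟨t, j⟩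
    simp
  rw [← Fintype.sum_prod_type' (f := fun t j => φ (Function.update j i t)),
    Fintype.sum_equiv hinv.toPerm (fun p => φ (Function.update p.2 i p.1)) (fun p => φ p.2)
      (fun p => rfl), Fintype.sum_prod_type]
  simp

theorem sum_comp_eval {N : ℕ} (i : Fin d) (φ : Fin N → ℝ) :
    N * ∑ j : Fin d → Fin N, φ (j i) = N ^ d * ∑ t, φ t := by
  rw [← sum_sum_update i]
  simp [Finset.mul_sum]

section gridOp

variable {N : ℕ} {w X : Fin d → ℕ → ℝ} {a b : Fin d → ℝ}

theorem gridOp_empty (hN : 0 < N) (G : (Fin d → ℝ) → ℝ) (x : Fin d → ℝ) :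
    gridOp N w X ∅ G x = G x := by
  have : (N : ℝ) ^ d ≠ 0 := by positivity
  simp [gridOp, this]

theorem gridOp_insert (hN : 0 < N) {v : Finset (Fin d)} {i : Fin d} (hi : i ∉ v)
    (G : (Fin d → ℝ) → ℝ) (x : Fin d → ℝ) :
    gridOp N w X (insert i v) G x = (1 / (N : ℝ)) * ∑ t ∈ Finset.range N,
      w i t * gridOp N w X v G (Function.update x i (X i t)) := by
  have hN' : (N : ℝ) ≠ 0 := by positivity
  have key := sum_sum_update (N := N) i fun j =>
    (∏ l ∈ insert i v, w l (j l)) * G ((insert i v).piecewise (fun l => X l (j l)) x)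
  rw [gridOp, ← mul_right_inj' hN', mul_left_comm, ← key, ← Fin.sum_univ_eq_sum_range
    (fun t => w i t * gridOp N w X v G (Function.update x i (X i t))), ← mul_assoc,
    mul_one_div_cancel hN', one_mul, Finset.mul_sum]
  refine Finset.sum_congr rfl fun t _ => ?_
  rw [gridOp, mul_left_comm, Finset.mul_sum (a := w i t)]
  congr 1
  refine Finset.sum_congr rfl fun j _ => ?_
  rw [Finset.prod_insert hi, mul_assoc]
  congr 2
  · simp
  · refine Finset.prod_congr rfl fun l hl => ?_
    rw [Function.update_of_ne (ne_of_mem_of_not_mem hl hi)]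
  · congr 1
    rw [Finset.piecewise_insert, Function.update_self, ← Finset.update_piecewise_of_notMem _ _ _ hi]
    ext l
    rcases eq_or_ne l i with rfl | h
    · simp
    · by_cases hl : l ∈ v <;> simp [h, hl]

theorem gridOp_hasDerivWithinAt (hX : ∀ i, ∀ t < N, X i t ∈ Set.Icc (a i) (b i))
    {v : Finset (Fin d)} {i : Fin d} (hi : i ∉ v)
    {G : (Fin d → ℝ) → ℝ} (hG : DiffInCoord a b i G) {x : Fin d → ℝ} (hx : x ∈ Set.Icc a b)
    {t : ℝ} (ht : t ∈ Set.Icc (a i) (b i)) :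
    HasDerivWithinAt (fun t => gridOp N w X v G (Function.update x i t))
      (gridOp N w X v (partialDeriv a b i G) (Function.update x i t)) (Set.Icc (a i) (b i)) t := by
  unfold gridOp
  refine HasDerivWithinAt.const_mul _ (HasDerivWithinAt.fun_sum fun j _ =>
    HasDerivWithinAt.const_mul _ ?_)
  simp only [← Finset.update_piecewise_of_notMem _ _ _ hi]
  exact hG.hasDerivWithinAt
    (piecewise_mem_Icc _ ⟨fun i => (hX i _ (j i).2).1, fun i => (hX i _ (j i).2).2⟩ hx) ht

/-- Induction from the end of the list, since the last coordinate is the first to be differentiated.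
The operator in the other coordinates is a finite sum, so it commutes with the derivative in `i`;
the one-dimensional bound then reduces `G` to `partialDeriv a b i G`. Partial derivatives are never
interchanged. -/
theorem abs_gridOp_le_of_partialDeriv (hN : 0 < N) (hab : ∀ i, a i < b i)
    (hX : ∀ i, ∀ t < N, X i t ∈ Set.Icc (a i) (b i)) {C : Fin d → ℝ} (l : List (Fin d)) :
    l.Nodup →
    (∀ i ∈ l, ∀ (h : ℝ → ℝ) (B : ℝ), DifferentiableOn ℝ h (Set.Icc (a i) (b i)) →
      (∀ t ∈ Set.Icc (a i) (b i), |derivWithin h (Set.Icc (a i) (b i)) t| ≤ B) →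
      |(1 / (N : ℝ)) * ∑ t ∈ Finset.range N, w i t * h (X i t)| ≤ C i * B) →
    ∀ (G : (Fin d → ℝ) → ℝ) (B : ℝ),
    (∀ p i q, l = p ++ i :: q →
      DiffInCoord a b i (q.foldr (fun i G => partialDeriv a b i G) G)) →
    (∀ x ∈ Set.Icc a b, |l.foldr (fun i G => partialDeriv a b i G) G x| ≤ B) →
    ∀ x ∈ Set.Icc a b, |gridOp N w X l.toFinset G x| ≤ (∏ i ∈ l.toFinset, C i) * B := by
  induction l using List.reverseRecOn with
  | nil =>
    intro _ _ G B _ hB x hx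
    simpa [gridOp_empty hN] using hB x hx
  | append_singleton l i ih =>
    intro hl hC G B hG hB x hx
    have hl' := List.nodup_append.1 hl
    have hi : i ∉ l.toFinset := by
      rw [List.mem_toFinset]
      exact fun h => hl'.2.2 i h i (List.mem_singleton_self i) rfl
    have hGi : DiffInCoord a b i G := hG l i [] rfl
    have hins : (l ++ [i]).toFinset = insert i l.toFinset := by
      ext k; simp
    have hder := ih hl'.1 (fun k hk => hC k (by simp [hk])) (partialDeriv a b i G) B
      (fun p k q h => by
        have := hG p k (q ++ [i]) (by rw [h]; simp)
        simpa using this)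
      (fun y hy => by simpa using hB y hy)
    rw [hins, gridOp_insert hN hi, Finset.prod_insert hi, mul_assoc]
    have hD := fun t (ht : t ∈ Set.Icc (a i) (b i)) =>
      gridOp_hasDerivWithinAt (w := w) hX hi hGi hx ht
    refine hC i (by simp) (fun t => gridOp N w X l.toFinset G (Function.update x i t)) _
      (fun t ht => (hD t ht).differentiableWithinAt) fun t ht => ?_
    rw [(hD t ht).derivWithin (uniqueDiffOn_Icc (hab i) t ht)]
    exact hder _ (update_mem_Icc hx ht)

/-- Averaging with weights of modulus at most 1 does not increase the supremum; this disposes of the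
coordinates in which nothing is differentiated. -/
theorem abs_gridOp_union_le (hN : 0 < N) (hX : ∀ i, ∀ t < N, X i t ∈ Set.Icc (a i) (b i))
    {u : Finset (Fin d)} {G : (Fin d → ℝ) → ℝ} {B : ℝ}
    (hB : ∀ x ∈ Set.Icc a b, |gridOp N w X u G x| ≤ B) (v : Finset (Fin d))
    (hw : ∀ i ∈ v, ∀ t < N, |w i t| ≤ 1) : Disjoint u v →
    ∀ x ∈ Set.Icc a b, |gridOp N w X (u ∪ v) G x| ≤ B := by
  induction v using Finset.induction_on with
  | empty => intro _; simpa using hB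
  | insert i v hi ih =>
    intro huv x hx
    rw [Finset.disjoint_insert_right] at huv
    have hN' : (0 : ℝ) < N := by positivity
    rw [Finset.union_insert, gridOp_insert hN (by simp [huv.1, hi]), abs_mul,
      abs_of_pos (by positivity), one_div, inv_mul_le_iff₀ hN']
    refine (Finset.abs_sum_le_sum_abs _ _).trans ((Finset.sum_le_card_nsmul _ _ B ?_).trans
      (by simp))
    intro t ht
    have ht := Finset.mem_range.1 ht
    have h1 := ih (fun k hk => hw k (Finset.mem_insert_of_mem hk)) huv.2 _
      (update_mem_Icc hx (hX i t ht))
    rw [abs_mul]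
    calc _ ≤ 1 * B := mul_le_mul (hw i (Finset.mem_insert_self _ _) t ht) h1 (abs_nonneg _)
          zero_le_one
      _ = B := one_mul B

end gridOp

/-- A tail `q` of an increasing list is the sorted list of its own set, and `i` precedes all of it.
-/
theorem HasMixedPartials.foldr_diffInCoord {a b : Fin d → ℝ} {F : (Fin d → ℝ) → ℝ}
    (hF : HasMixedPartials a b F) {u : Finset (Fin d)} {p q : List (Fin d)} {i : Fin d}
    (h : u.sort (· ≤ ·) = p ++ i :: q) :
    DiffInCoord a b i (q.foldr (fun i G => partialDeriv a b i G) F) := by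
  have hs : (p ++ i :: q).Pairwise (· < ·) := h ▸ Finset.sortedLT_sort u |>.pairwise
  have hq := (List.pairwise_append.1 hs).2.1
  rw [List.pairwise_cons] at hq
  have hsort : q.toFinset.sort (· ≤ ·) = q :=
    (List.toFinset_sort _ (hq.2.imp fun h => ne_of_lt h)).2 (hq.2.imp fun h => le_of_lt h)
  have := hF q.toFinset i (fun j hj => hq.1 j (List.mem_toFinset.1 hj))
  rwa [mixedPartial, hsort] at this

theorem abs_mixedPartial_le {a b : Fin d → ℝ} {γ : Finset (Fin d) → ℝ} {F : (Fin d → ℝ) → ℝ}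
    (hγ : ∀ u, 0 < γ u) (hF : weightedNorm ∞ a b γ F ≤ 1) (u : Finset (Fin d))
    {x : Fin d → ℝ} (hx : x ∈ Set.Icc a b) : |mixedPartial a b u F x| ≤ γ u := by
  rw [weightedNorm, if_pos rfl, iSup_le_iff] at hF
  have h := hF u
  have h0 : ENNReal.ofReal (γ u) ≠ 0 := by simpa using hγ u
  rw [normTerm, ENNReal.inv_mul_le_iff h0 ENNReal.ofReal_ne_top, mul_one, iSup₂_le_iff] at h
  exact (ENNReal.ofReal_le_ofReal_iff (hγ u).le).1 (h x hx)

theorem partialDeriv_eq_mixedPartial_singleton (a b : Fin d → ℝ) (i : Fin d)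
    (F : (Fin d → ℝ) → ℝ) : partialDeriv a b i F = mixedPartial a b {i} F := by
  simp [mixedPartial]

theorem HasMixedPartials.diffInCoord {a b : Fin d → ℝ} {F : (Fin d → ℝ) → ℝ}
    (hF : HasMixedPartials a b F) (i : Fin d) : DiffInCoord a b i F := by
  simpa [mixedPartial, DiffInCoord] using hF ∅ i (by simp)

/-- A function with bounded partial derivatives is Lipschitz continuous on the cube. -/
theorem abs_sub_le_sum_of_partialDeriv {a b : Fin d → ℝ} {F : (Fin d → ℝ) → ℝ} {B : Fin d → ℝ}
    (hab : ∀ i, a i < b i)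
    (hF : ∀ i, DiffInCoord a b i F) (hB : ∀ i, ∀ x ∈ Set.Icc a b, |partialDeriv a b i F x| ≤ B i)
    {x y : Fin d → ℝ} (hx : x ∈ Set.Icc a b) (hy : y ∈ Set.Icc a b) :
    |F x - F y| ≤ ∑ i, B i * |x i - y i| := by
  have key : ∀ v : Finset (Fin d), |F (v.piecewise x y) - F y| ≤ ∑ i ∈ v, B i * |x i - y i| := by
    intro v
    induction v using Finset.induction_on with
    | empty => simp
    | insert i v hi ih =>
      rw [Finset.sum_insert hi]
      have hz := piecewise_mem_Icc v hx hy
      have hD := fun t (ht : t ∈ Set.Icc (a i) (b i)) => (hF i).hasDerivWithinAt hz ht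
      have h1 := (convex_Icc (a i) (b i)).norm_image_sub_le_of_norm_derivWithin_le (C := B i)
        (f := fun t => F (Function.update (v.piecewise x y) i t)) (x := y i) (y := x i)
        (fun t ht => (hD t ht).differentiableWithinAt)
        (fun t ht => by
          rw [(hD t ht).derivWithin (uniqueDiffOn_Icc (hab i) t ht)]
          exact hB i _ (update_mem_Icc hz ht)) ⟨hy.1 i, hy.2 i⟩ ⟨hx.1 i, hx.2 i⟩
      have h2 : Function.update (v.piecewise x y) i (y i) = v.piecewise x y := by
        rw [Function.update_eq_self_iff]; simp [hi]
      simp only [h2, Real.norm_eq_abs] at h1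
      rw [Finset.piecewise_insert]
      calc _ ≤ _ := abs_sub_le _ (F (v.piecewise x y)) _
        _ ≤ _ := add_le_add h1 ih
  simpa using key Finset.univ

end Cube

/-! ### Quantiles of an invertible distribution function -/

section Quantiles

variable {a b : ℝ} {φ : ℝ → ℝ}

theorem IsInvertiblePDF.intervalIntegrable (h : IsInvertiblePDF a b φ) {x y : ℝ}
    (hx : x ∈ Set.Icc a b) (hy : y ∈ Set.Icc a b) : IntervalIntegrable φ volume x y :=
  (h.integrable.mono_set (Set.uIcc_subset_Icc hx hy)).intervalIntegrable

theorem IsInvertiblePDF.integral_eq_cdf_sub (h : IsInvertiblePDF a b φ) {x y : ℝ}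
    (hx : x ∈ Set.Icc a b) (hy : y ∈ Set.Icc a b) :
    ∫ t in x..y, φ t = cdf a φ y - cdf a φ x := by
  have ha : a ∈ Set.Icc a b := ⟨le_rfl, hx.1.trans hx.2⟩
  exact (intervalIntegral.integral_interval_sub_left (h.intervalIntegrable ha hy)
    (h.intervalIntegrable ha hx)).symm

theorem IsInvertiblePDF.cdf_le_cdf (h : IsInvertiblePDF a b φ) {x y : ℝ}
    (hx : x ∈ Set.Icc a b) (hy : y ∈ Set.Icc a b) (hxy : x ≤ y) : cdf a φ x ≤ cdf a φ y := by
  rw [← sub_nonneg, ← h.integral_eq_cdf_sub hx hy]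
  exact intervalIntegral.integral_nonneg hxy fun t ht =>
    h.nonneg t ⟨hx.1.trans ht.1, ht.2.trans hy.2⟩

theorem IsInvertiblePDF.invCdf_mem (h : IsInvertiblePDF a b φ) {y : ℝ} (hy : y ∈ Set.Icc 0 1) :
    invCdf a b φ y ∈ Set.Icc a b :=
  Function.invFunOn_mem (h.bijOn_cdf.surjOn hy)

theorem IsInvertiblePDF.cdf_invCdf (h : IsInvertiblePDF a b φ) {y : ℝ} (hy : y ∈ Set.Icc 0 1) :
    cdf a φ (invCdf a b φ y) = y :=
  Function.invFunOn_eq (h.bijOn_cdf.surjOn hy)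

theorem IsInvertiblePDF.invCdf_le_invCdf (h : IsInvertiblePDF a b φ) {y z : ℝ}
    (hy : y ∈ Set.Icc 0 1) (hz : z ∈ Set.Icc 0 1) (hyz : y ≤ z) :
    invCdf a b φ y ≤ invCdf a b φ z := by
  by_contra! hlt
  have h1 := h.cdf_le_cdf (h.invCdf_mem hz) (h.invCdf_mem hy) hlt.le
  rw [h.cdf_invCdf hy, h.cdf_invCdf hz] at h1
  rw [le_antisymm h1 hyz] at hlt
  exact lt_irrefl _ hlt

theorem IsInvertiblePDF.invCdf_zero (h : IsInvertiblePDF a b φ) (hab : a < b) :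
    invCdf a b φ 0 = a := by
  have h0 : (0 : ℝ) ∈ Set.Icc (0 : ℝ) 1 := ⟨le_rfl, zero_le_one⟩
  refine h.bijOn_cdf.injOn (h.invCdf_mem h0) ⟨le_rfl, hab.le⟩ ?_
  rw [h.cdf_invCdf h0, cdf, intervalIntegral.integral_same]

theorem IsInvertiblePDF.invCdf_one (h : IsInvertiblePDF a b φ) (hab : a < b) :
    invCdf a b φ 1 = b := by
  have h1 : (1 : ℝ) ∈ Set.Icc (0 : ℝ) 1 := ⟨zero_le_one, le_rfl⟩
  refine h.bijOn_cdf.injOn (h.invCdf_mem h1) ⟨hab.le, le_rfl⟩ ?_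
  rw [h.cdf_invCdf h1, cdf, h.integral_eq_one]

end Quantiles

theorem natCast_div_mem_Icc {N t : ℕ} (ht : t ≤ N) : (t : ℝ) / N ∈ Set.Icc (0 : ℝ) 1 :=
  ⟨by positivity, div_le_one_of_le₀ (by exact_mod_cast ht) (by positivity)⟩

/-! ### Partition of a cube into cells -/

theorem exists_mem_Ioc_of_mem_Ioc {X : ℕ → ℝ} {N : ℕ} {x : ℝ} (hx : x ∈ Set.Ioc (X 0) (X N)) :
    ∃ t < N, x ∈ Set.Ioc (X t) (X (t + 1)) := by
  classical
  have hex : ∃ t, x ≤ X t := ⟨N, hx.2⟩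
  have h0 : Nat.find hex ≠ 0 := fun h => by
    have := Nat.find_spec hex
    rw [h] at this
    exact absurd this (not_le.2 hx.1)
  obtain ⟨t, ht⟩ := Nat.exists_eq_succ_of_ne_zero h0
  refine ⟨t, ?_, ?_, ?_⟩
  · have := Nat.find_min' hex hx.2
    omega
  · exact not_le.1 (Nat.find_min hex (by omega))
  · rw [← Nat.succ_eq_add_one, ← ht]
    exact Nat.find_spec hex

section Cells

variable {d N : ℕ} {X : Fin d → ℕ → ℝ}

/-- The cell of the grid with the nodes `X i 0, …, X i N` in coordinate `i`. -/
def cell (X : Fin d → ℕ → ℝ) (j : Fin d → Fin N) : Set (Fin d → ℝ) :=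
  Set.univ.pi fun i => Set.Ioc (X i (j i)) (X i ((j i : ℕ) + 1))

theorem measurableSet_cell (j : Fin d → Fin N) : MeasurableSet (cell X j) :=
  MeasurableSet.univ_pi fun _ => measurableSet_Ioc

theorem pairwise_disjoint_cell (hX : ∀ i, ∀ t t', t ≤ t' → t' ≤ N → X i t ≤ X i t') :
    Pairwise (Function.onFun Disjoint fun j : Fin d → Fin N => cell X j) := by
  intro j j' hj
  rw [Function.onFun, Set.disjoint_left]
  intro x hx hx'
  refine hj (funext fun i => Fin.ext ?_)
  have h1 := hx i trivial
  have h2 := hx' i trivial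
  by_contra hne
  rcases lt_or_gt_of_ne hne with hlt | hlt
  · have := hX i _ _ (Nat.succ_le_of_lt hlt) (j' i).2.le
    exact absurd (h1.2.trans this) (not_le.2 h2.1)
  · have := hX i _ _ (Nat.succ_le_of_lt hlt) (j i).2.le
    exact absurd (h2.2.trans this) (not_le.2 h1.1)

theorem iUnion_cell (hX : ∀ i, ∀ t t', t ≤ t' → t' ≤ N → X i t ≤ X i t') :
    ⋃ j : Fin d → Fin N, cell X j = Set.univ.pi fun i => Set.Ioc (X i 0) (X i N) := by
  ext x
  simp only [Set.mem_iUnion]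
  constructor
  · rintro ⟨j, hj⟩ i -
    have h := hj i trivial
    exact ⟨(hX i 0 _ (Nat.zero_le _) (j i).2.le).trans_lt h.1,
      h.2.trans (hX i _ N (j i).2 le_rfl)⟩
  · intro hx
    choose t ht htx using fun i => exists_mem_Ioc_of_mem_Ioc (hx i trivial)
    exact ⟨fun i => ⟨t i, ht i⟩, fun i _ => htx i⟩

theorem setIntegral_cell_prod (φ : Fin d → ℝ → ℝ) (j : Fin d → Fin N) :
    ∫ x in cell X j, ∏ i, φ i (x i) =
      ∏ i, ∫ t in Set.Ioc (X i (j i)) (X i ((j i : ℕ) + 1)), φ i t := by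
  rw [cell, volume_pi, Measure.restrict_pi_pi, integral_fintype_prod_eq_prod]

end Cells

section Quadrature

variable {d N : ℕ} {a b : Fin d → ℝ} {φ : Fin d → ℝ → ℝ} {F : (Fin d → ℝ) → ℝ} {B : Fin d → ℝ}

theorem integrableOn_prod (hφ : ∀ i, IntegrableOn (φ i) (Set.Icc (a i) (b i))) :
    IntegrableOn (fun x : Fin d → ℝ => ∏ i, φ i (x i)) (Set.Icc a b) := by
  rw [IntegrableOn, ← Set.pi_univ_Icc, volume_pi, Measure.restrict_pi_pi]
  exact Integrable.fintype_prod hφ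

theorem continuousOn_of_abs_sub_le_sum {s : Set (Fin d → ℝ)}
    (hF : ∀ x ∈ s, ∀ y ∈ s, |F x - F y| ≤ ∑ i, B i * |x i - y i|) : ContinuousOn F s := by
  intro y hy
  rw [ContinuousWithinAt, tendsto_iff_dist_tendsto_zero]
  have hlim : Filter.Tendsto (fun x : Fin d → ℝ => ∑ i, B i * |x i - y i|) (nhdsWithin y s)
      (nhds 0) := by
    have hc : Continuous fun x : Fin d → ℝ => ∑ i, B i * |x i - y i| := by fun_prop
    have := hc.tendsto y
    simp only [sub_self, abs_zero, mul_zero, Finset.sum_const_zero] at this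
    exact this.mono_left nhdsWithin_le_nhds
  refine squeeze_zero' (Filter.Eventually.of_forall fun _ => dist_nonneg) ?_ hlim
  filter_upwards [self_mem_nhdsWithin] with x hx
  exact hF x hx y hy

theorem integrableOn_mul_prod (hF : ContinuousOn F (Set.Icc a b))
    (hφ : ∀ i, IntegrableOn (φ i) (Set.Icc (a i) (b i))) :
    IntegrableOn (fun x => F x * ∏ i, φ i (x i)) (Set.Icc a b) := by
  obtain ⟨C, hC⟩ := isCompact_Icc.exists_bound_of_continuousOn hF
  exact Integrable.bdd_mul (integrableOn_prod hφ) (hF.aestronglyMeasurable measurableSet_Icc)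
    ((ae_restrict_iff' measurableSet_Icc).2 (Filter.Eventually.of_forall hC))

/-- The average of a Lipschitz function over the quantile grid approximates its integral. -/
theorem abs_gridAverage_sub_integral_le (hN : 0 < N) (hab : ∀ i, a i < b i)
    (hφ : ∀ i, IsInvertiblePDF (a i) (b i) (φ i)) (hB : ∀ i, 0 ≤ B i)
    (hF : ∀ x ∈ Set.Icc a b, ∀ y ∈ Set.Icc a b, |F x - F y| ≤ ∑ i, B i * |x i - y i|) :
    |(1 / (N : ℝ) ^ d) * ∑ j : Fin d → Fin N,
        F (fun i => invCdf (a i) (b i) (φ i) ((j i : ℕ) / (N : ℝ)))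
      - ∫ x in Set.Icc a b, F x * ∏ i, φ i (x i)| ≤
      (1 / (N : ℝ)) * ∑ i, B i * (b i - a i) := by
  have hN' : (N : ℝ) ≠ 0 := by positivity
  set X : Fin d → ℕ → ℝ := fun i t => invCdf (a i) (b i) (φ i) ((t : ℝ) / N) with hXdef
  have hXmem : ∀ i, ∀ t ≤ N, X i t ∈ Set.Icc (a i) (b i) := fun i t ht =>
    (hφ i).invCdf_mem (natCast_div_mem_Icc ht)
  have hmono : ∀ i, ∀ t t', t ≤ t' → t' ≤ N → X i t ≤ X i t' := fun i t t' h h' =>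
    (hφ i).invCdf_le_invCdf (natCast_div_mem_Icc (h.trans h')) (natCast_div_mem_Icc h')
      (by gcongr)
  have hX0 : ∀ i, X i 0 = a i := fun i => by simp [hXdef, (hφ i).invCdf_zero (hab i)]
  have hXN : ∀ i, X i N = b i := fun i => by simp [hXdef, hN', (hφ i).invCdf_one (hab i)]
  have hcell : ∀ j : Fin d → Fin N, cell X j ⊆ Set.Icc a b := fun j x hx =>
    ⟨fun i => (hXmem i _ (j i).2.le).1.trans (hx i trivial).1.le,
      fun i => (hx i trivial).2.trans (hXmem i _ (j i).2).2⟩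
  have hint := integrableOn_mul_prod (continuousOn_of_abs_sub_le_sum hF) fun i => (hφ i).integrable
  have hprod := integrableOn_prod (a := a) (b := b) fun i => (hφ i).integrable
  -- In each coordinate the distribution function grows by exactly `1 / N` between consecutive
  -- quantiles.
  have hmass : ∀ j : Fin d → Fin N, ∫ x in cell X j, ∏ i, φ i (x i) = 1 / (N : ℝ) ^ d := by
    intro j
    rw [setIntegral_cell_prod, Finset.prod_congr rfl fun i _ => ?_, Finset.prod_const,
      Finset.card_univ, Fintype.card_fin, ← one_div_pow]
    rw [← intervalIntegral.integral_of_le (hmono i _ _ (Nat.le_succ _) (j i).2),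
      (hφ i).integral_eq_cdf_sub (hXmem i _ (j i).2.le) (hXmem i _ (j i).2),
      (hφ i).cdf_invCdf (natCast_div_mem_Icc (j i).2),
      (hφ i).cdf_invCdf (natCast_div_mem_Icc (j i).2.le)]
    push_cast
    ring
  have hsplit : ∫ x in Set.Icc a b, F x * ∏ i, φ i (x i) =
      ∑ j : Fin d → Fin N, ∫ x in cell X j, F x * ∏ i, φ i (x i) := by
    rw [← integral_iUnion_fintype measurableSet_cell (pairwise_disjoint_cell hmono)
      (fun j => hint.mono_set (hcell j)), iUnion_cell hmono]
    simp only [hX0, hXN]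
    exact setIntegral_congr_set (by rw [volume_pi]; exact Measure.univ_pi_Ioc_ae_eq_Icc.symm)
  have hterm : ∀ j : Fin d → Fin N,
      |1 / (N : ℝ) ^ d * F (fun i => X i (j i)) - ∫ x in cell X j, F x * ∏ i, φ i (x i)| ≤
        1 / (N : ℝ) ^ d * ∑ i, B i * (X i ((j i : ℕ) + 1) - X i (j i)) := by
    intro j
    have hnode : (fun i => X i (j i)) ∈ Set.Icc a b :=
      ⟨fun i => (hXmem i _ (j i).2.le).1, fun i => (hXmem i _ (j i).2.le).2⟩
    have hp := hprod.mono_set (hcell j)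
    rw [← hmass j, ← integral_mul_const, ← integral_sub (hp.mul_const _)
      (hint.mono_set (hcell j)), ← integral_mul_const, ← Real.norm_eq_abs]
    refine norm_integral_le_of_norm_le (hp.mul_const _) ?_
    rw [ae_restrict_iff' (measurableSet_cell j)]
    refine Filter.Eventually.of_forall fun x hx => ?_
    have hφ0 : 0 ≤ ∏ i, φ i (x i) := Finset.prod_nonneg fun i _ =>
      (hφ i).nonneg _ ⟨(hcell j hx).1 i, (hcell j hx).2 i⟩
    rw [mul_comm (F x), ← mul_sub, norm_mul, Real.norm_of_nonneg hφ0, Real.norm_eq_abs]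
    refine mul_le_mul_of_nonneg_left ((hF _ hnode _ (hcell j hx)).trans
      (Finset.sum_le_sum fun i _ => mul_le_mul_of_nonneg_left ?_ (hB i))) hφ0
    have := hx i trivial
    rw [abs_sub_comm, abs_of_nonneg (sub_nonneg.2 this.1.le)]
    exact sub_le_sub_right this.2 _
  rw [hsplit, Finset.mul_sum, ← Finset.sum_sub_distrib]
  refine (Finset.abs_sum_le_sum_abs _ _).trans ((Finset.sum_le_sum fun j _ => hterm j).trans
    (le_of_eq ?_))
  rw [← Finset.mul_sum, Finset.sum_comm, Finset.mul_sum, Finset.mul_sum]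
  refine Finset.sum_congr rfl fun i _ => ?_
  rw [← Finset.mul_sum]
  -- The widths in coordinate `i` telescope to `b i - a i` along each line of cells, so their
  -- average over all cells is `(b i - a i) / N`.
  have h1 := sum_comp_eval (N := N) i fun t => X i ((t : ℕ) + 1) - X i t
  rw [Fin.sum_univ_eq_sum_range (fun t => X i (t + 1) - X i t), Finset.sum_range_sub, hX0, hXN]
    at h1
  have h2 : (N : ℝ) ^ d ≠ 0 := pow_ne_zero _ hN'
  field_simp
  linear_combination (B i) * h1

end Quadrature

/-! ### Walsh expansion of the error on the dyadic grid -/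

section WalshExpansion

variable {d m : ℕ}

theorem sum_prod_gridWal_mul (j j' : Fin d → Fin (2 ^ m)) :
    ∑ k : Fin d → Fin (2 ^ m), (∏ i, gridWal m (k i) (j i)) * ∏ i, gridWal m (k i) (j' i) =
      if j = j' then ((2 : ℝ) ^ m) ^ d else 0 := by
  have h1 : ∀ i, ∑ k : Fin (2 ^ m), gridWal m k (j i) * gridWal m k (j' i) =
      if j i = j' i then (2 : ℝ) ^ m else 0 := fun i => by
    rw [Fin.sum_univ_eq_sum_range (fun k => gridWal m k (j i) * gridWal m k (j' i)),
      sum_gridWal_mul_gridWal m _ _ (j i).2 (j' i).2]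
    simp only [Fin.ext_iff]
  simp only [← Finset.prod_mul_distrib]
  rw [← Fintype.piFinset_univ, ← Finset.prod_univ_sum (fun _ => Finset.univ)
    (fun i (k : Fin (2 ^ m)) => gridWal m k (j i) * gridWal m k (j' i))]
  simp only [h1]
  split_ifs with h
  · simp [h]
  · obtain ⟨i, hi⟩ := Function.ne_iff.1 h
    exact Finset.prod_eq_zero (Finset.mem_univ i) (if_neg hi)

theorem walsh_expansion (A : (Fin d → Fin (2 ^ m)) → ℝ) (j : Fin d → Fin (2 ^ m)) :
    A j = ∑ k : Fin d → Fin (2 ^ m),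
      ((1 / ((2 : ℝ) ^ m) ^ d) * ∑ j', (∏ i, gridWal m (k i) (j' i)) * A j') *
        ∏ i, gridWal m (k i) (j i) := by
  have h : ∀ k : Fin d → Fin (2 ^ m),
      ((1 / ((2 : ℝ) ^ m) ^ d) * ∑ j', (∏ i, gridWal m (k i) (j' i)) * A j') *
        ∏ i, gridWal m (k i) (j i) = ∑ j', (1 / ((2 : ℝ) ^ m) ^ d) * A j' *
          ((∏ i, gridWal m (k i) (j i)) * ∏ i, gridWal m (k i) (j' i)) := fun k => by
    rw [Finset.mul_sum, Finset.sum_mul]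
    exact Finset.sum_congr rfl fun j' _ => by ring
  rw [Finset.sum_congr rfl fun k _ => h k, Finset.sum_comm]
  simp only [← Finset.mul_sum, sum_prod_gridWal_mul]
  have h2 : ((2 : ℝ) ^ m) ^ d ≠ 0 := by positivity
  simp only [mul_ite, mul_zero, Finset.sum_ite_eq, Finset.mem_univ, if_true]
  field_simp

/-- The set of the coordinates in which `k` does not vanish. -/
def indexSupport (k : Fin d → Fin (2 ^ m)) : Finset (Fin d) :=
  Finset.univ.filter fun i => (k i : ℕ) ≠ 0

theorem mem_indexSupport {k : Fin d → Fin (2 ^ m)} {i : Fin d} :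
    i ∈ indexSupport k ↔ (k i : ℕ) ≠ 0 := by simp [indexSupport]

/-- Frequencies on `u` are extended by zero, which is harmless as `wal 0 = 1`; the Walsh expansion
can then be grouped by support. -/
theorem walshSum_eq_sum_indexSupport {ι : Type} [Fintype ι] (P : ι → Fin d → ℝ)
    (u : Finset (Fin d)) :
    walshSum m P u = ∑ k : Fin d → Fin (2 ^ m) with indexSupport k = u,
      (∏ i ∈ u, (1 / 2 ^ Nat.size (k i) : ℝ)) *
        |(1 / 2 ^ m : ℝ) * ∑ n : ι, ∏ i, wal (k i) (P n i)| := by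
  have hpos : 0 < 2 ^ m := by positivity
  symm
  refine Finset.sum_bij (fun k _ => fun l : {i // i ∈ u} => (k l : ℕ)) ?_ ?_ ?_ ?_
  · intro k hk
    obtain rfl := (Finset.mem_filter.1 hk).2
    rw [Fintype.mem_piFinset]
    intro l
    have h1 := mem_indexSupport.1 l.2
    have h2 := (k l).2
    rw [Finset.mem_Icc]
    omega
  · intro k hk k' hk' h
    have hu := (Finset.mem_filter.1 hk).2
    have hu' := (Finset.mem_filter.1 hk').2
    funext i
    by_cases hi : i ∈ u
    · exact Fin.ext (congrFun h ⟨i, hi⟩)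
    · have h1 : (k i : ℕ) = 0 := by_contra fun h => hi (hu ▸ mem_indexSupport.2 h)
      have h2 : (k' i : ℕ) = 0 := by_contra fun h => hi (hu' ▸ mem_indexSupport.2 h)
      exact Fin.ext (h1.trans h2.symm)
  · intro k hk
    rw [Fintype.mem_piFinset] at hk
    simp only [Finset.mem_Icc] at hk
    refine ⟨fun i => if h : i ∈ u then ⟨k ⟨i, h⟩, by have := hk ⟨i, h⟩; omega⟩ else ⟨0, hpos⟩,
      ?_, ?_⟩
    · rw [Finset.mem_filter]
      refine ⟨Finset.mem_univ _, ?_⟩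
      ext i
      rw [mem_indexSupport]
      by_cases h : i ∈ u
      · have := hk ⟨i, h⟩
        simp only [h, dif_pos]
        simp only [iff_true]
        omega
      · simp [h]
    · funext l
      simp
  · intro k hk
    have hu := (Finset.mem_filter.1 hk).2
    congr 1
    · rw [← Finset.prod_coe_sort, Finset.prod_div_distrib, Finset.prod_const_one,
        Finset.prod_pow_eq_pow_sum]
    · congr 2
      refine Finset.sum_congr rfl fun n _ => ?_
      rw [Finset.prod_coe_sort u fun i => wal (k i) (P n i)]
      refine (Finset.prod_subset (Finset.subset_univ u) fun i _ hi => ?_).symm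
      have h1 : (k i : ℕ) = 0 := by_contra fun h => hi (hu ▸ mem_indexSupport.2 h)
      rw [h1, wal_zero]

variable {a b : Fin d → ℝ} {γ : Finset (Fin d) → ℝ} {φ : Fin d → ℝ → ℝ} {F : (Fin d → ℝ) → ℝ}

/-- The coefficient is `gridOp` over all coordinates with Walsh weights. Those in the support gain
the factor `(b i - a i) / 2 ^ μ (k i)` by summation by parts; the others cost nothing. -/
theorem abs_walshCoeff_le (hab : ∀ i, a i < b i) (hγ : ∀ u, 0 < γ u)
    (hφ : ∀ i, IsInvertiblePDF (a i) (b i) (φ i)) (hF : HasMixedPartials a b F)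
    (hnorm : weightedNorm ∞ a b γ F ≤ 1) (k : Fin d → Fin (2 ^ m)) :
    |(1 / ((2 : ℝ) ^ m) ^ d) * ∑ j : Fin d → Fin (2 ^ m), (∏ i, gridWal m (k i) (j i)) *
        F (fun i => invCdf (a i) (b i) (φ i) ((j i : ℕ) / (2 : ℝ) ^ m))| ≤
      γ (indexSupport k) * ((∏ i ∈ indexSupport k, (b i - a i)) *
        ∏ i ∈ indexSupport k, (1 / 2 ^ Nat.size (k i) : ℝ)) := by
  set u := indexSupport k with hu
  have hN : 0 < 2 ^ m := by positivity
  have hcast : ((2 ^ m : ℕ) : ℝ) = (2 : ℝ) ^ m := by push_cast; rfl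
  set X : Fin d → ℕ → ℝ := fun i t => invCdf (a i) (b i) (φ i) ((t : ℝ) / (2 : ℝ) ^ m)
    with hXdef
  have hmem : ∀ t : ℕ, t ≤ 2 ^ m → (t : ℝ) / (2 : ℝ) ^ m ∈ Set.Icc (0 : ℝ) 1 := fun t ht => by
    rw [← hcast]; exact natCast_div_mem_Icc ht
  have hX : ∀ i, ∀ t < 2 ^ m, X i t ∈ Set.Icc (a i) (b i) := fun i t ht =>
    (hφ i).invCdf_mem (hmem t ht.le)
  set w : Fin d → ℕ → ℝ := fun i => gridWal m (k i)
  have haMem : a ∈ Set.Icc a b := ⟨le_rfl, fun i => (hab i).le⟩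
  have hop := abs_gridOp_le_of_partialDeriv (w := w) (X := X) hN hab hX
    (C := fun i => (b i - a i) * (1 / 2 ^ Nat.size (k i))) (u.sort (· ≤ ·))
    (Finset.sort_nodup _ _)
    (fun i hi h B hd hB => by
      have hki : 1 ≤ (k i : ℕ) :=
        Nat.one_le_iff_ne_zero.2 (mem_indexSupport.1 ((Finset.mem_sort _).1 hi))
      have h1 := abs_sum_mul_le_of_partialSum_le (X := X i) (w := w i) hN hd hB (hX i)
        (fun t ht => (hφ i).invCdf_le_invCdf (hmem _ (by omega)) (hmem _ ht.le)
          (by push_cast; gcongr; linarith))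
        (sum_gridWal_eq_zero (k i).2 hki) (fun t ht => abs_sum_gridWal_le (k i).2 hki ht)
      rw [abs_mul, abs_of_pos (by positivity), hcast]
      refine (mul_le_mul_of_nonneg_left h1 (by positivity)).trans (le_of_eq ?_)
      field_simp)
    F (γ u) (fun p i q h => hF.foldr_diffInCoord h)
    (fun x hx => abs_mixedPartial_le hγ hnorm u hx)
  rw [Finset.sort_toFinset] at hop
  -- Once all coordinates are averaged, the base point `a` no longer matters.
  have hall := abs_gridOp_union_le hN hX hop uᶜ
    (fun i _ t _ => (abs_gridWal m _ _).le) disjoint_compl_right a haMem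
  rw [Finset.union_compl, gridOp, hcast, Finset.prod_mul_distrib] at hall
  simp only [Finset.piecewise_univ] at hall
  rw [mul_comm (γ u)]
  exact hall

theorem abs_integrationError_le {ι : Type} [Fintype ι] (hι : Fintype.card ι = 2 ^ m)
    (hab : ∀ i, a i < b i) (hγ : ∀ u, 0 < γ u)
    (hφ : ∀ i, IsInvertiblePDF (a i) (b i) (φ i)) (hF : HasMixedPartials a b F)
    (hnorm : weightedNorm ∞ a b γ F ≤ 1) (P : ι → Fin d → ℝ) (J : ι → Fin d → Fin (2 ^ m))
    (hP : ∀ n i, P n i = (J n i : ℕ) / (2 : ℝ) ^ m) :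
    |integrationError P a b φ F| ≤
      (∑ u ∈ (Finset.univ : Finset (Finset (Fin d))).filter (fun u => u.Nonempty),
        γ u * (∏ i ∈ u, (b i - a i)) * walshSum m P u) +
      (1 / 2 ^ m) * ∑ i, γ {i} * (b i - a i) := by
  have hN : 0 < 2 ^ m := by positivity
  have hcast : ((2 ^ m : ℕ) : ℝ) = (2 : ℝ) ^ m := by push_cast; rfl
  set A : (Fin d → Fin (2 ^ m)) → ℝ := fun j =>
    F (fun i => invCdf (a i) (b i) (φ i) ((j i : ℕ) / (2 : ℝ) ^ m)) with hA
  set coeff : (Fin d → Fin (2 ^ m)) → ℝ := fun k =>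
    (1 / ((2 : ℝ) ^ m) ^ d) * ∑ j', (∏ i, gridWal m (k i) (j' i)) * A j' with hcoeff
  set c : (Fin d → Fin (2 ^ m)) → ℝ := fun k =>
    (1 / 2 ^ m : ℝ) * ∑ n : ι, ∏ i, wal (k i) (P n i) with hc
  have hquad := abs_gridAverage_sub_integral_le hN hab hφ (B := fun i => γ {i})
    (fun i => (hγ _).le) (fun x hx y hy => abs_sub_le_sum_of_partialDeriv hab hF.diffInCoord
      (fun i z hz => by
        rw [partialDeriv_eq_mixedPartial_singleton]
        exact abs_mixedPartial_le hγ hnorm {i} hz) hx hy)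
  rw [hcast] at hquad
  have hexp : (1 / (2 : ℝ) ^ m) * ∑ n, A (J n) = ∑ k, coeff k * c k := by
    have h1 : ∀ n, A (J n) = ∑ k, coeff k * ∏ i, wal (k i) (P n i) := fun n => by
      rw [walsh_expansion A (J n)]
      refine Finset.sum_congr rfl fun k _ => ?_
      congr 1
      refine Finset.prod_congr rfl fun i _ => ?_
      rw [hP, wal_div_two_pow (k i).2]
    simp only [h1, hc]
    rw [Finset.sum_comm, Finset.mul_sum]
    refine Finset.sum_congr rfl fun k _ => ?_
    rw [← Finset.mul_sum]
    ring
  have hk0 : ∀ k : Fin d → Fin (2 ^ m), indexSupport k = ∅ ↔ k = fun _ => ⟨0, hN⟩ := fun k => by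
    simp only [Finset.eq_empty_iff_forall_notMem, mem_indexSupport, not_not, funext_iff,
      Fin.ext_iff]
  have hzero : ∑ k with indexSupport k = ∅, coeff k * c k =
      (1 / ((2 : ℝ) ^ m) ^ d) * ∑ j, A j := by
    simp only [hk0]
    rw [Finset.sum_filter, Finset.sum_ite_eq' Finset.univ, if_pos (Finset.mem_univ _)]
    simp [hc, hcoeff, wal_zero, gridWal_zero_left, hι]
  have hfib := Finset.sum_fiberwise (Finset.univ : Finset (Fin d → Fin (2 ^ m))) indexSupport
    fun k => coeff k * c k
  have hsplit : (1 / (2 : ℝ) ^ m) * ∑ n, A (J n) = (1 / ((2 : ℝ) ^ m) ^ d) * ∑ j, A j +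
      ∑ u ∈ (Finset.univ : Finset (Finset (Fin d))).filter (fun u => u.Nonempty),
        ∑ k with indexSupport k = u, coeff k * c k := by
    rw [hexp, ← hfib, ← hzero, ← Finset.add_sum_erase _ _ (Finset.mem_univ ∅)]
    congr 1
    refine Finset.sum_congr ?_ fun _ _ => rfl
    ext u
    simp [Finset.nonempty_iff_ne_empty]
  have herr : integrationError P a b φ F =
      (∑ u ∈ (Finset.univ : Finset (Finset (Fin d))).filter (fun u => u.Nonempty),
        ∑ k with indexSupport k = u, coeff k * c k) +
      ((1 / ((2 : ℝ) ^ m) ^ d) * ∑ j, A j - ∫ x in Set.Icc a b, F x * ∏ i, φ i (x i)) := by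
    have : ∀ n, F (fun i => invCdf (a i) (b i) (φ i) (P n i)) = A (J n) := fun n => by
      simp only [hA, hP]
    rw [integrationError, hι, hcast]
    simp only [this]
    rw [hsplit]
    ring
  rw [herr]
  refine (abs_add_le _ _).trans (add_le_add ?_ hquad)
  refine (Finset.abs_sum_le_sum_abs _ _).trans (Finset.sum_le_sum fun u _ => ?_)
  rw [walshSum_eq_sum_indexSupport, Finset.mul_sum]
  refine (Finset.abs_sum_le_sum_abs _ _).trans (Finset.sum_le_sum fun k hk => ?_)
  obtain rfl := (Finset.mem_filter.1 hk).2
  rw [abs_mul, ← mul_assoc, mul_assoc (γ _)]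
  exact mul_le_mul_of_nonneg_right (abs_walshCoeff_le hab hγ hφ hF hnorm k) (abs_nonneg _)

end WalshExpansion

/-! ### Laurent series of rational functions over `𝔽₂` -/

theorem laurentOfPoly_add (p q : (ZMod 2)[X]) :
    laurentOfPoly (p + q) = laurentOfPoly p + laurentOfPoly q := map_add _ p q

theorem laurentOfPoly_mul (p q : (ZMod 2)[X]) :
    laurentOfPoly (p * q) = laurentOfPoly p * laurentOfPoly q := map_mul _ p q

theorem laurentOfPoly_monomial (n : ℕ) (c : ZMod 2) :
    laurentOfPoly (monomial n c) = HahnSeries.single (-(n : ℤ)) c := by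
  rw [laurentOfPoly, aeval_monomial, HahnSeries.single_pow]
  have hc : c = 0 ∨ c = 1 := by revert c; decide
  rcases hc with rfl | rfl <;> simp

theorem coeff_laurentOfPoly_neg (p : (ZMod 2)[X]) (n : ℕ) :
    (laurentOfPoly p).coeff (-(n : ℤ)) = p.coeff n := by
  induction p using Polynomial.induction_on' with
  | add p q hp hq => rw [laurentOfPoly_add, HahnSeries.coeff_add, hp, hq, coeff_add]
  | monomial k c =>
    rw [laurentOfPoly_monomial, coeff_monomial, HahnSeries.coeff_single]
    simp [eq_comm]

theorem coeff_laurentOfPoly_of_pos (p : (ZMod 2)[X]) {k : ℤ} (hk : 0 < k) :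
    (laurentOfPoly p).coeff k = 0 := by
  induction p using Polynomial.induction_on' with
  | add p q hp hq => rw [laurentOfPoly_add, HahnSeries.coeff_add, hp, hq, add_zero]
  | monomial n c =>
    rw [laurentOfPoly_monomial, HahnSeries.coeff_single_of_ne (by omega)]

theorem laurentOfPoly_ne_zero {p : (ZMod 2)[X]} (hp : p ≠ 0) : laurentOfPoly p ≠ 0 := by
  intro h
  have := coeff_laurentOfPoly_neg p p.natDegree
  rw [h, HahnSeries.coeff_zero] at this
  exact leadingCoeff_ne_zero.2 hp this.symm

theorem order_laurentOfPoly {p : (ZMod 2)[X]} (hp : p ≠ 0) :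
    (laurentOfPoly p).order = -(p.natDegree : ℤ) := by
  refine le_antisymm (HahnSeries.order_le_of_coeff_ne_zero ?_) ?_
  · rw [coeff_laurentOfPoly_neg]
    exact leadingCoeff_ne_zero.2 hp
  · by_contra! hlt
    obtain ⟨n, hn⟩ : ∃ n : ℕ, (laurentOfPoly p).order = -(n : ℤ) :=
      ⟨(-(laurentOfPoly p).order).toNat, by omega⟩
    have h := mt HahnSeries.coeff_order_eq_zero.1 (laurentOfPoly_ne_zero hp)
    rw [hn, coeff_laurentOfPoly_neg] at h
    have := le_natDegree_of_ne_zero h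
    omega

/-- The series of `p / f` has order `deg f - deg p`, which lies between 1 and `deg f`. -/
theorem exists_coeff_div_ne_zero {p f : (ZMod 2)[X]} (hp : p ≠ 0)
    (hdeg : p.natDegree < f.natDegree) :
    ∃ j < f.natDegree, (laurentOfPoly p / laurentOfPoly f).coeff ((j + 1 : ℕ) : ℤ) ≠ 0 := by
  have hf : f ≠ 0 := by rintro rfl; simp at hdeg
  have hq : laurentOfPoly p / laurentOfPoly f ≠ 0 :=
    div_ne_zero (laurentOfPoly_ne_zero hp) (laurentOfPoly_ne_zero hf)
  have h := HahnSeries.order_mul hq (laurentOfPoly_ne_zero hf)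
  rw [div_mul_cancel₀ _ (laurentOfPoly_ne_zero hf), order_laurentOfPoly hp,
    order_laurentOfPoly hf] at h
  refine ⟨f.natDegree - p.natDegree - 1, by omega, ?_⟩
  have ho : ((f.natDegree - p.natDegree - 1 + 1 : ℕ) : ℤ) =
      (laurentOfPoly p / laurentOfPoly f).order := by omega
  rw [ho]
  exact mt HahnSeries.coeff_order_eq_zero.1 hq

/-! ### Characters of the group of residues -/

theorem val_zmod_two_lt (x : LaurentSeries (ZMod 2)) (k : ℕ) : (x.coeff (k : ℤ)).val < 2 :=
  ZMod.val_lt _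

theorem fracPart_eq_digitNat (m : ℕ) (x : LaurentSeries (ZMod 2)) :
    fracPart m x = (digitNat (fun k => (x.coeff (k : ℤ)).val) m : ℝ) / 2 ^ m :=
  sum_digits_div_two_pow _ m

theorem wal_fracPart {m k : ℕ} (hk : k < 2 ^ m) (x : LaurentSeries (ZMod 2)) :
    wal k (fracPart m x) = ∏ j ∈ Finset.range m,
      ((-1 : ℝ) ^ (x.coeff ((j + 1 : ℕ) : ℤ)).val) ^ (k / 2 ^ j % 2) := by
  rw [fracPart_eq_digitNat, wal_div_two_pow hk, gridWal_digitNat (val_zmod_two_lt x)]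

theorem neg_one_pow_val_add (x y : ZMod 2) :
    (-1 : ℝ) ^ (x + y).val = (-1) ^ x.val * (-1) ^ y.val := by
  rw [ZMod.val_add, ← neg_one_pow_eq_pow_mod_two, pow_add]

/-- Laurent coefficients add modulo 2 without carries, so Walsh functions become characters. -/
theorem wal_fracPart_add {m k : ℕ} (hk : k < 2 ^ m) (x y : LaurentSeries (ZMod 2)) :
    wal k (fracPart m (x + y)) = wal k (fracPart m x) * wal k (fracPart m y) := by
  simp only [wal_fracPart hk, ← Finset.prod_mul_distrib, HahnSeries.coeff_add,
    neg_one_pow_val_add, mul_pow]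

theorem wal_mem (k : ℕ) (x : ℝ) : wal k x = 1 ∨ wal k x = -1 := neg_one_pow_eq_or ℝ _

/-- The value of the `k`-th Walsh function at the truncated fractional part of `p / f`. -/
noncomputable def resChar (m : ℕ) (f : (ZMod 2)[X]) (k : ℕ) (p : (ZMod 2)[X]) : ℝ :=
  wal k (fracPart m (laurentOfPoly p / laurentOfPoly f))

section resChar

variable {m k : ℕ} {f : (ZMod 2)[X]}

theorem resChar_mem (p : (ZMod 2)[X]) : resChar m f k p = 1 ∨ resChar m f k p = -1 :=
  wal_mem _ _

theorem resChar_add (hk : k < 2 ^ m) (p q : (ZMod 2)[X]) :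
    resChar m f k (p + q) = resChar m f k p * resChar m f k q := by
  rw [resChar, laurentOfPoly_add, add_div, wal_fracPart_add hk]
  rfl

theorem resChar_mul_right (hk : k < 2 ^ m) (hf : f ≠ 0) (q : (ZMod 2)[X]) :
    resChar m f k (f * q) = 1 := by
  rw [resChar, laurentOfPoly_mul, mul_div_cancel_left₀ _ (laurentOfPoly_ne_zero hf),
    wal_fracPart hk]
  refine Finset.prod_eq_one fun j _ => ?_
  rw [coeff_laurentOfPoly_of_pos _ (by omega)]
  simp

theorem card_Gpoly (m : ℕ) : Fintype.card (Gpoly m) = 2 ^ m := by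
  rw [Fintype.card_congr (Polynomial.degreeLTEquiv (ZMod 2) m).toEquiv]
  simp [ZMod.card]

/-- The first `m` digits of `r / f` determine `r`, and there are `2 ^ m` residues; hence every digit
pattern occurs, in particular a single 1 at the top bit of `k`. -/
theorem exists_resChar_eq_neg_one (hk1 : 1 ≤ k) (hk : k < 2 ^ m) (hm : f.natDegree = m) :
    ∃ r : Gpoly m, resChar m f k r = -1 := by
  set D : Gpoly m → Fin m → ZMod 2 := fun r j =>
    (laurentOfPoly (r : (ZMod 2)[X]) / laurentOfPoly f).coeff ((j + 1 : ℕ) : ℤ) with hD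
  have hinj : Function.Injective D := by
    intro r r' h
    by_contra hne
    have h0 : (r : (ZMod 2)[X]) - r' ≠ 0 := sub_ne_zero.2 fun h => hne (Subtype.ext h)
    have hdeg : ((r : (ZMod 2)[X]) - r').natDegree < f.natDegree := by
      rw [hm]
      exact (natDegree_lt_iff_degree_lt h0).2 (mem_degreeLT.1 (sub_mem r.2 r'.2))
    obtain ⟨j, hj, hne⟩ := exists_coeff_div_ne_zero h0 hdeg
    have hr : laurentOfPoly (r : (ZMod 2)[X]) =
        laurentOfPoly ((r : (ZMod 2)[X]) - r') + laurentOfPoly (r' : (ZMod 2)[X]) := by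
      rw [← laurentOfPoly_add, sub_add_cancel]
    have h2 := congrFun h ⟨j, hm ▸ hj⟩
    simp only [hD] at h2
    rw [hr, add_div, HahnSeries.coeff_add, add_eq_right] at h2
    exact hne h2
  have hbij := (Fintype.bijective_iff_injective_and_card D).2
    ⟨hinj, by rw [card_Gpoly]; simp [ZMod.card]⟩
  obtain ⟨j, hj, hkj⟩ : ∃ j < m, k / 2 ^ j % 2 = 1 := by
    have hs : 0 < Nat.size k := Nat.size_pos.2 hk1
    refine ⟨Nat.size k - 1, by have := Nat.size_le.2 hk; omega, ?_⟩
    have h1 : 2 ^ (Nat.size k - 1) ≤ k := Nat.lt_size.1 (by omega)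
    have h2 : k < 2 ^ (Nat.size k - 1 + 1) := by
      rw [Nat.sub_add_cancel hs]; exact Nat.lt_size_self k
    rw [pow_succ] at h2
    rw [show k / 2 ^ (Nat.size k - 1) = 1 from
      Nat.div_eq_of_lt_le (by omega) (by omega)]
  obtain ⟨r, hr⟩ := hbij.2 (Pi.single ⟨j, hj⟩ 1)
  refine ⟨r, ?_⟩
  rw [resChar, wal_fracPart hk, Finset.prod_eq_single j]
  · have := congrFun hr ⟨j, hj⟩
    simp only [hD, Pi.single_eq_same] at this
    rw [this, hkj]
    simp [ZMod.val_one]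
  · intro l hl hlj
    have := congrFun hr ⟨l, Finset.mem_range.1 hl⟩
    rw [Pi.single_eq_of_ne (by simpa using hlj)] at this
    simp only [hD] at this
    rw [this]
    simp
  · exact fun h => absurd (Finset.mem_range.2 hj) h

/-- A nonzero `p` would be invertible modulo `f`, so its multiples would reach a residue where the
character is `-1`; multiples of `f` do not affect the character. -/
theorem eq_zero_of_resChar_mul_eq_one (hf : Irreducible f) (hm : f.natDegree = m)
    (hk1 : 1 ≤ k) (hk : k < 2 ^ m) {p : (ZMod 2)[X]} (hp : p ∈ degreeLT (ZMod 2) m)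
    (h : ∀ r : Gpoly m, resChar m f k (r * p) = 1) : p = 0 := by
  by_contra h0
  have hdeg : p.natDegree < f.natDegree := by
    rw [hm]
    exact (natDegree_lt_iff_degree_lt h0).2 (mem_degreeLT.1 hp)
  have hcop : IsCoprime f p := hf.coprime_iff_not_dvd.2 fun hd =>
    absurd (natDegree_le_of_dvd hd h0) (not_le.2 hdeg)
  obtain ⟨u, v, huv⟩ := hcop
  obtain ⟨r, hr⟩ := exists_resChar_eq_neg_one hk1 hk hm
  have hmem : (v * r) % f ∈ degreeLT (ZMod 2) m := by
    have hlt := EuclideanDomain.mod_lt (v * (r : (ZMod 2)[X])) hf.ne_zero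
    rw [mem_degreeLT]
    exact hlt.trans_eq ((degree_eq_natDegree hf.ne_zero).trans (by rw [hm]))
  have h1 := h ⟨_, hmem⟩
  have h2 : (v * r) % f * p + f * ((v * r) / f * p + u * r) = (r : (ZMod 2)[X]) := by
    have h3 := EuclideanDomain.mod_add_div (v * (r : (ZMod 2)[X])) f
    linear_combination p * h3 + (r : (ZMod 2)[X]) * huv
  rw [← h2, resChar_add hk, resChar_mul_right hk hf.ne_zero, mul_one] at hr
  rw [hr] at h1
  norm_num at h1

end resChar

theorem sum_eq_zero_of_character {G : Type*} [AddGroup G] [Fintype G] {χ : G → ℝ}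
    (hadd : ∀ x y, χ (x + y) = χ x * χ y) {x : G} (hx : χ x = -1) : ∑ y, χ y = 0 := by
  have h := Equiv.sum_comp (Equiv.addRight x) χ
  simp only [Equiv.coe_addRight, hadd, hx, mul_neg, mul_one, Finset.sum_neg_distrib] at h
  linarith

theorem sum_resChar_eq_zero {m k : ℕ} {f : (ZMod 2)[X]} (hm : f.natDegree = m)
    (hk1 : 1 ≤ k) (hk : k < 2 ^ m) : ∑ h : Gpoly m, resChar m f k h = 0 := by
  obtain ⟨r, hr⟩ := exists_resChar_eq_neg_one hk1 hk hm
  exact sum_eq_zero_of_character (χ := fun h : Gpoly m => resChar m f k h)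
    (fun x y => by simpa using resChar_add hk (x : (ZMod 2)[X]) y) hr

/-- Multiplying a character by the characters `h ↦ resChar m f k (h * r)`, `r ∈ G_m`, yields the
trivial character at most once. -/
theorem sum_abs_sum_mul_resChar_le {m k : ℕ} {f : (ZMod 2)[X]} (hf : Irreducible f)
    (hm : f.natDegree = m) (hk1 : 1 ≤ k) (hk : k < 2 ^ m) {χ : Gpoly m → ℝ}
    (hadd : ∀ x y, χ (x + y) = χ x * χ y) (hχ : ∀ x, χ x = 1 ∨ χ x = -1) :
    ∑ r : Gpoly m, |(1 / 2 ^ m : ℝ) * ∑ h : Gpoly m, χ h * resChar m f k (h * r)| ≤ 1 := by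
  set ψ : Gpoly m → Gpoly m → ℝ := fun r h => χ h * resChar m f k (h * r) with hψ
  have hψadd : ∀ r x y, ψ r (x + y) = ψ r x * ψ r y := fun r x y => by
    simp only [hψ, hadd, Submodule.coe_add, add_mul, resChar_add hk]
    ring
  have hψmem : ∀ r x, ψ r x = 1 ∨ ψ r x = -1 := fun r x => by
    rcases hχ x with h1 | h1 <;>
      rcases resChar_mem (m := m) (f := f) (k := k) ((x : (ZMod 2)[X]) * r) with h2 | h2 <;>
      simp [hψ, h1, h2]
  have hle : ∀ r, |(1 / 2 ^ m : ℝ) * ∑ h, ψ r h| ≤ 1 := fun r => by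
    rw [abs_mul, abs_of_pos (by positivity), one_div, inv_mul_le_iff₀ (by positivity), mul_one]
    refine (Finset.abs_sum_le_sum_abs _ _).trans
      ((Finset.sum_le_card_nsmul _ _ 1 fun h _ => ?_).trans ?_)
    · rcases hψmem r h with h1 | h1 <;> simp [h1]
    · simp [card_Gpoly]
  have hone : ∀ r, ∑ h, ψ r h ≠ 0 → ∀ h, ψ r h = 1 := fun r hr h =>
    (hψmem r h).resolve_right fun h1 => hr (sum_eq_zero_of_character (hψadd r) h1)
  by_cases hex : ∃ r, ∑ h, ψ r h ≠ 0
  · obtain ⟨r, hr⟩ := hex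
    rw [Finset.sum_eq_single r]
    · exact hle r
    · intro r' _ hne
      by_contra hr'
      have hr'' : ∑ h, ψ r' h ≠ 0 := fun h0 => hr' (by
        change |(1 / 2 ^ m : ℝ) * ∑ h, ψ r' h| = 0
        rw [h0, mul_zero, abs_zero])
      -- If `r` and `r'` both give the trivial character, so does their quotient, which is the
      -- character attached to `r' - r`.
      refine hne (Subtype.ext (sub_eq_zero.1 (eq_zero_of_resChar_mul_eq_one hf hm hk1 hk
        (sub_mem r'.2 r.2) fun h => ?_)))
      have h1 := hone r hr h
      have h2 := hone r' hr'' h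
      have h3 : resChar m f k (h * r') = resChar m f k (h * ((r' : (ZMod 2)[X]) - r)) *
          resChar m f k (h * r) := by
        rw [← resChar_add hk, ← mul_add, sub_add_cancel]
      simp only [hψ, h3] at h1 h2
      linear_combination h2 - resChar m f k (h * ((r' : (ZMod 2)[X]) - r)) * h1
    · simp
  · push Not at hex
    have : ∀ r, |(1 / 2 ^ m : ℝ) * ∑ h, ψ r h| = 0 := fun r => by rw [hex, mul_zero, abs_zero]
    exact (Finset.sum_eq_zero fun r _ => this r).le.trans zero_le_one

/-! ### Averages of the Walsh sums of polynomial lattice point sets -/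

theorem walshSum_map {d s m : ℕ} {ι : Type} [Fintype ι] (e : Fin d ↪ Fin s)
    (P : ι → Fin s → ℝ) (u : Finset (Fin d)) :
    walshSum m (fun n i => P n (e i)) u = walshSum m P (u.map e) := by
  set E : {i // i ∈ u} ≃ {i // i ∈ u.map e} := Equiv.ofBijective
    (fun i => ⟨e i, Finset.mem_map_of_mem e i.2⟩)
    ⟨fun i l h => Subtype.ext (e.injective (congrArg Subtype.val h)), fun ⟨l, hl⟩ => by
      obtain ⟨i, hi, rfl⟩ := Finset.mem_map.1 hl
      exact ⟨⟨i, hi⟩, rfl⟩⟩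
  have hval : ∀ i : {i // i ∈ u}, (E i : Fin s) = e i := fun i => rfl
  refine Finset.sum_equiv (Equiv.arrowCongr E (Equiv.refl ℕ)) (fun k => ?_) fun k _ => ?_
  · simp only [Fintype.mem_piFinset, Equiv.arrowCongr_apply, Function.comp_apply,
      Equiv.coe_refl, id_eq]
    exact (E.symm.forall_congr_right (q := fun i => k i ∈ Finset.Icc 1 (2 ^ m - 1))).symm
  · congr 1
    · rw [← Equiv.sum_comp E]
      simp
    · congr 2
      refine Finset.sum_congr rfl fun n _ => ?_
      rw [← Equiv.prod_comp E]
      simp [hval]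

theorem walshSum_congr {s m : ℕ} {ι : Type} [Fintype ι] {P P' : ι → Fin s → ℝ}
    {u : Finset (Fin s)} (h : ∀ n, ∀ i ∈ u, P n i = P' n i) :
    walshSum m P u = walshSum m P' u := by
  unfold walshSum
  refine Finset.sum_congr rfl fun k _ => ?_
  congr 3
  refine Finset.sum_congr rfl fun n _ => Finset.prod_congr rfl fun i _ => ?_
  rw [h n i i.2]

section PolynomialLattice

variable {s m : ℕ} {f : (ZMod 2)[X]}

theorem wal_polyLattice (g : Fin s → (ZMod 2)[X]) (k : ℕ) (h : Gpoly m) (i : Fin s) :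
    wal k (polyLattice m g f h i) = resChar m f k (h * g i) := rfl

theorem mem_Icc_one_two_pow_sub_one {k : ℕ} (hk : k ∈ Finset.Icc 1 (2 ^ m - 1)) :
    1 ≤ k ∧ k < 2 ^ m := by
  have := Nat.one_le_two_pow (n := m)
  rw [Finset.mem_Icc] at hk
  omega

/-- For fixed `k`, the coordinates other than `i` form a character independent of `r`, so the sum
over `r` is at most 1. What remains is a product of the sums `∑ 2 ^ (-μ k) = m / 2`. -/
theorem sum_walshSum_update_le (hf : Irreducible f) (hm : f.natDegree = m)
    (g : Fin s → (ZMod 2)[X]) {i : Fin s} {u : Finset (Fin s)} (hi : i ∈ u) :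
    ∑ r : Gpoly m, walshSum m (polyLattice m (Function.update g i (r : (ZMod 2)[X])) f) u ≤
      ((m : ℝ) / 2) ^ u.card := by
  unfold walshSum
  rw [Finset.sum_comm]
  have hsum : ((m : ℝ) / 2) ^ u.card =
      ∑ k ∈ Fintype.piFinset (fun _ : {i // i ∈ u} => Finset.Icc 1 (2 ^ m - 1)),
        (1 / 2 ^ (∑ i, Nat.size (k i)) : ℝ) := by
    have h := Finset.prod_univ_sum (fun _ : {i // i ∈ u} => Finset.Icc 1 (2 ^ m - 1))
      (fun _ k => (1 / 2 ^ Nat.size k : ℝ))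
    simp only [sum_inv_two_pow_size, Finset.prod_const, Finset.card_univ,
      Fintype.card_coe] at h
    rw [h]
    refine Finset.sum_congr rfl fun k _ => ?_
    rw [Finset.prod_div_distrib, Finset.prod_const_one, Finset.prod_pow_eq_pow_sum]
  rw [hsum]
  refine Finset.sum_le_sum fun k hk => ?_
  rw [← Finset.mul_sum]
  refine mul_le_of_le_one_right (by positivity) ?_
  have hk' := fun l => mem_Icc_one_two_pow_sub_one (Fintype.mem_piFinset.1 hk l)
  set χ : Gpoly m → ℝ := fun h => ∏ l ∈ Finset.univ.erase (⟨i, hi⟩ : {i // i ∈ u}),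
    resChar m f (k l) (h * g l) with hχ
  have hadd : ∀ x y, χ (x + y) = χ x * χ y := fun x y => by
    simp only [hχ, ← Finset.prod_mul_distrib]
    refine Finset.prod_congr rfl fun l _ => ?_
    rw [Submodule.coe_add, add_mul, resChar_add (hk' l).2]
  have hmem : ∀ x, χ x = 1 ∨ χ x = -1 := fun x => by
    refine Finset.prod_induction _ (fun y => y = 1 ∨ y = -1) ?_ (Or.inl rfl)
      fun l _ => resChar_mem _
    rintro _ _ (rfl | rfl) (rfl | rfl) <;> simp
  refine le_of_eq_of_le ?_ (sum_abs_sum_mul_resChar_le hf hm (hk' ⟨i, hi⟩).1 (hk' ⟨i, hi⟩).2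
    hadd hmem)
  refine Finset.sum_congr rfl fun r _ => ?_
  congr 2
  refine Finset.sum_congr rfl fun h _ => ?_
  rw [← Finset.mul_prod_erase _ _ (Finset.mem_univ (⟨i, hi⟩ : {i // i ∈ u})), mul_comm]
  congr 1
  · refine Finset.prod_congr rfl fun l hl => ?_
    have hne : (l : Fin s) ≠ i := fun h => (Finset.mem_erase.1 hl).1 (Subtype.ext h)
    rw [wal_polyLattice, Function.update_of_ne hne]
  · rw [wal_polyLattice, Function.update_self]

theorem walshSum_singleton_eq_zero (hm : f.natDegree = m) {g : Fin s → (ZMod 2)[X]} {i : Fin s}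
    (hgi : g i = 1) : walshSum m (polyLattice m g f) {i} = 0 := by
  unfold walshSum
  refine Finset.sum_eq_zero fun k hk => ?_
  have hk' := mem_Icc_one_two_pow_sub_one
    (Fintype.mem_piFinset.1 hk ⟨i, Finset.mem_singleton_self i⟩)
  have h : ∀ h : Gpoly m, ∏ l : {l // l ∈ ({i} : Finset (Fin s))},
      wal (k l) (polyLattice m g f h (l : Fin s)) =
        resChar m f (k ⟨i, Finset.mem_singleton_self i⟩) h := fun h => by
    rw [Fintype.prod_unique]
    change wal (k ⟨i, _⟩) (polyLattice m g f h i) = _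
    rw [wal_polyLattice, hgi, mul_one]
  simp only [h, sum_resChar_eq_zero hm hk'.1 hk'.2]
  simp

end PolynomialLattice

/-! ### The component-by-component construction -/

section CBC

variable {s : ℕ}

/-- The nonempty subsets of the first `d` coordinates. -/
def initSubsets (s d : ℕ) : Finset (Finset (Fin s)) :=
  Finset.univ.filter fun u => u.Nonempty ∧ ∀ i ∈ u, (i : ℕ) < d

theorem mem_initSubsets {d : ℕ} {u : Finset (Fin s)} :
    u ∈ initSubsets s d ↔ u.Nonempty ∧ ∀ i ∈ u, (i : ℕ) < d := by simp [initSubsets]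

theorem sum_nonempty_map_castLEEmb {d : ℕ} (hd : d ≤ s) (G : Finset (Fin s) → ℝ) :
    ∑ u ∈ (Finset.univ : Finset (Finset (Fin d))).filter (fun u => u.Nonempty),
      G (u.map (Fin.castLEEmb hd)) = ∑ u ∈ initSubsets s d, G u := by
  refine Finset.sum_bij (fun u _ => u.map (Fin.castLEEmb hd)) ?_ ?_ ?_ fun _ _ => rfl
  · intro u hu
    rw [mem_initSubsets]
    refine ⟨by simpa using hu, fun i hi => ?_⟩
    obtain ⟨l, _, rfl⟩ := Finset.mem_map.1 hi
    exact l.2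
  · intro u _ v _ h
    exact Finset.map_injective _ h
  · intro u hu
    rw [mem_initSubsets] at hu
    have hmap : (Finset.univ.filter fun l : Fin d => Fin.castLE hd l ∈ u).map
        (Fin.castLEEmb hd) = u := by
      ext i
      simp only [Finset.mem_map, Finset.mem_filter, Finset.mem_univ, true_and, Fin.coe_castLEEmb]
      constructor
      · rintro ⟨l, hl, rfl⟩
        exact hl
      · exact fun hi => ⟨⟨i, hu.2 i hi⟩, hi, rfl⟩
    refine ⟨_, ?_, hmap⟩
    rw [Finset.mem_filter, ← Finset.map_nonempty (f := Fin.castLEEmb hd), hmap]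
    exact ⟨Finset.mem_univ _, hu.1⟩

theorem figureOfMerit_initVec {m d : ℕ} (hd : d ≤ s) (a b : Fin s → ℝ)
    (γ : Finset (Fin s) → ℝ) (g : Fin s → (ZMod 2)[X]) (f : (ZMod 2)[X]) :
    figureOfMerit m (initVec hd a) (initVec hd b) (initWeights hd γ) (initVec hd g) f =
      ∑ u ∈ initSubsets s d,
        γ u * (∏ i ∈ u, (b i - a i)) * walshSum m (polyLattice m g f) u := by
  rw [← sum_nonempty_map_castLEEmb hd]
  refine Finset.sum_congr rfl fun u _ => ?_
  rw [← walshSum_map, Finset.prod_map]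
  rfl

theorem snoc_initVec {α : Type} {d : ℕ} (hd : d + 1 ≤ s) (g : Fin s → α) (h : α) :
    Fin.snoc (α := fun _ => α) (initVec (Nat.le_of_succ_le hd) g) h =
      initVec hd (Function.update g ⟨d, hd⟩ h) := by
  funext i
  refine Fin.lastCases ?_ (fun l => ?_) i
  · rw [Fin.snoc_last, initVec]
    exact (Function.update_self (⟨d, hd⟩ : Fin s) h g).symm
  · rw [Fin.snoc_castSucc, initVec, initVec, Function.update_of_ne]
    · rfl
    · exact fun h => (ne_of_lt l.2) (congrArg Fin.val h)

variable {m : ℕ} {a b : Fin s → ℝ} {γ : Finset (Fin s) → ℝ} {f : (ZMod 2)[X]}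
  {g : Fin s → (ZMod 2)[X]}

/-- Subsets avoiding the new coordinate contribute equally for every candidate and cancel, so the
minimizer also minimizes the part of the sum containing it; a minimum is at most the average over
`G_m`. -/
theorem IsCBC.sum_last_le (hab : ∀ i, a i < b i) (hγ : ∀ u, 0 < γ u) (hf : Irreducible f)
    (hm : f.natDegree = m) (hg : IsCBC m a b γ f g) {d : ℕ} (hd1 : 1 ≤ d) (hd : d + 1 ≤ s) :
    ∑ u ∈ initSubsets s (d + 1) with (⟨d, hd⟩ : Fin s) ∈ u,
      γ u * (∏ i ∈ u, (b i - a i)) * walshSum m (polyLattice m g f) u ≤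
    (1 / 2 ^ m : ℝ) * ∑ u ∈ initSubsets s (d + 1) with (⟨d, hd⟩ : Fin s) ∈ u,
      γ u * (∏ i ∈ u, (b i - a i)) * ((m : ℝ) / 2) ^ u.card := by
  obtain ⟨i, hi⟩ : ∃ i : Fin s, i = ⟨d, hd⟩ := ⟨_, rfl⟩
  rw [← hi]
  have hc : ∀ u : Finset (Fin s), 0 ≤ γ u * ∏ i ∈ u, (b i - a i) := fun u =>
    mul_nonneg (hγ u).le (Finset.prod_nonneg fun i _ => sub_nonneg.2 (hab i).le)
  have hrest : ∀ r : Gpoly m,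
      ∑ u ∈ initSubsets s (d + 1) with i ∉ u, γ u * (∏ i ∈ u, (b i - a i)) *
        walshSum m (polyLattice m (Function.update g i (r : (ZMod 2)[X])) f) u =
      ∑ u ∈ initSubsets s (d + 1) with i ∉ u,
        γ u * (∏ i ∈ u, (b i - a i)) * walshSum m (polyLattice m g f) u := fun r => by
    refine Finset.sum_congr rfl fun u hu => ?_
    rw [walshSum_congr fun n l hl => ?_]
    have hne : l ≠ i := ne_of_mem_of_not_mem hl (Finset.mem_filter.1 hu).2
    rw [polyLattice, polyLattice, Function.update_of_ne hne]
  have hmin : ∀ r : Gpoly m,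
      ∑ u ∈ initSubsets s (d + 1) with i ∈ u,
        γ u * (∏ i ∈ u, (b i - a i)) * walshSum m (polyLattice m g f) u ≤
      ∑ u ∈ initSubsets s (d + 1) with i ∈ u, γ u * (∏ i ∈ u, (b i - a i)) *
        walshSum m (polyLattice m (Function.update g i (r : (ZMod 2)[X])) f) u := fun r => by
    have h := hg.minimal d hd hd1 r r.2
    rw [snoc_initVec hd, figureOfMerit_initVec, figureOfMerit_initVec, ← hi,
      ← Finset.sum_filter_add_sum_filter_not _ (fun u => i ∈ u),
      ← Finset.sum_filter_add_sum_filter_not (initSubsets s (d + 1)) (fun u => i ∈ u)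
        (fun u => γ u * (∏ i ∈ u, (b i - a i)) *
          walshSum m (polyLattice m (Function.update g i (r : (ZMod 2)[X])) f) u)] at h
    rw [hrest r] at h
    exact le_of_add_le_add_right h
  have hsum := Finset.sum_le_sum fun r (_ : r ∈ (Finset.univ : Finset (Gpoly m))) => hmin r
  rw [Finset.sum_const, Finset.card_univ, card_Gpoly, nsmul_eq_mul, Finset.sum_comm] at hsum
  push_cast at hsum
  rw [one_div, le_inv_mul_iff₀ (by positivity)]
  refine hsum.trans (Finset.sum_le_sum fun u hu => ?_)
  rw [← Finset.mul_sum]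
  exact mul_le_mul_of_nonneg_left
    (sum_walshSum_update_le hf hm g (Finset.mem_filter.1 hu).2) (hc u)

theorem IsCBC.sum_walshSum_le (hab : ∀ i, a i < b i) (hγ : ∀ u, 0 < γ u) (hf : Irreducible f)
    (hm : f.natDegree = m) (hg : IsCBC m a b γ f g) {d : ℕ} (hd1 : 1 ≤ d) : d ≤ s →
    ∑ u ∈ initSubsets s d, γ u * (∏ i ∈ u, (b i - a i)) * walshSum m (polyLattice m g f) u ≤
    (1 / 2 ^ m : ℝ) * ∑ u ∈ initSubsets s d,
      γ u * (∏ i ∈ u, (b i - a i)) * ((m : ℝ) / 2) ^ u.card := by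
  have hc : ∀ u : Finset (Fin s), 0 ≤ γ u * ∏ i ∈ u, (b i - a i) := fun u =>
    mul_nonneg (hγ u).le (Finset.prod_nonneg fun i _ => sub_nonneg.2 (hab i).le)
  induction d, hd1 using Nat.le_induction with
  | base =>
    intro h1
    -- With first component 1, each sum is that of a nontrivial character over all residues, hence
    -- zero.
    have hzero : ∀ u ∈ initSubsets s 1,
        γ u * (∏ i ∈ u, (b i - a i)) * walshSum m (polyLattice m g f) u = 0 := fun u hu => by
      rw [mem_initSubsets] at hu
      obtain ⟨⟨i, hi⟩, hlt⟩ := hu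
      have hi0 : (i : ℕ) = 0 := Nat.lt_one_iff.1 (hlt i hi)
      have hu : u = {i} := Finset.eq_singleton_iff_unique_mem.2 ⟨hi, fun l hl =>
        Fin.ext ((Nat.lt_one_iff.1 (hlt l hl)).trans hi0.symm)⟩
      rw [hu, walshSum_singleton_eq_zero hm (hg.first i hi0), mul_zero]
    rw [Finset.sum_eq_zero hzero]
    exact mul_nonneg (by positivity) (Finset.sum_nonneg fun u _ => mul_nonneg (hc u)
      (by positivity))
  | succ d hd1 ih =>
    intro hd
    have hrest : (initSubsets s (d + 1)).filter (fun u => (⟨d, hd⟩ : Fin s) ∉ u) =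
        initSubsets s d := by
      ext u
      rw [Finset.mem_filter, mem_initSubsets, mem_initSubsets, and_assoc, and_congr_right_iff]
      refine fun _ => ⟨fun h i hi => ?_, fun h => ⟨fun i hi => (h i hi).trans (Nat.lt_succ_self d),
        fun hi => lt_irrefl _ (h _ hi)⟩⟩
      refine lt_of_le_of_ne (Nat.lt_succ_iff.1 (h.1 i hi)) fun hid => h.2 ?_
      rwa [show (⟨d, hd⟩ : Fin s) = i from Fin.ext hid.symm]
    rw [← Finset.sum_filter_add_sum_filter_not (initSubsets s (d + 1))
        (fun u => (⟨d, hd⟩ : Fin s) ∈ u),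
      ← Finset.sum_filter_add_sum_filter_not (initSubsets s (d + 1))
        (fun u => (⟨d, hd⟩ : Fin s) ∈ u)
        (fun u => γ u * (∏ i ∈ u, (b i - a i)) * ((m : ℝ) / 2) ^ u.card), hrest, mul_add]
    exact add_le_add (hg.sum_last_le hab hγ hf hm hd1 hd) (ih (Nat.le_of_succ_le hd))

end CBC

end WeightedQMC

theorem mainTheorem6 (s m : ℕ) (a b : Fin s → ℝ) (hab : ∀ i, a i < b i)
    (γ : Finset (Fin s) → ℝ) (hγ : ∀ u, 0 < γ u)
    (f : (ZMod 2)[X]) (hf : Irreducible f) (hm : f.natDegree = m)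
    (g : Fin s → (ZMod 2)[X]) (hg : IsCBC m a b γ f g) :
    ∀ (d : ℕ) (_ : 1 ≤ d) (hd : d ≤ s) (φ : Fin d → ℝ → ℝ),
      (∀ i, IsInvertiblePDF (initVec hd a i) (initVec hd b i) (φ i)) →
      wce (polyLattice m (initVec hd g) f) ∞ (initVec hd a) (initVec hd b) (initWeights hd γ) φ ≤
        ENNReal.ofReal ((1 / 2 ^ m : ℝ) *
          ∑ u ∈ (Finset.univ : Finset (Finset (Fin d))).filter (fun u => u.Nonempty),
            initWeights hd γ u * ((2 : ℝ) ^ u.card + ((m : ℝ) / 2) ^ u.card) *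
              ∏ i ∈ u, (initVec hd b i - initVec hd a i)) := by
  intro d hd1 hd φ hφ
  have hab' : ∀ i, initVec hd a i < initVec hd b i := fun i => hab _
  have hγ' : ∀ u, 0 < initWeights hd γ u := fun u => hγ _
  refine iSup_le fun F => iSup_le fun hF => iSup_le fun hnorm => ENNReal.ofReal_le_ofReal ?_
  have herr := abs_integrationError_le (card_Gpoly m) hab' hγ' hφ hF hnorm
    (polyLattice m (initVec hd g) f) (fun h i => ⟨_, digitNat_lt (val_zmod_two_lt
      (laurentOfPoly ((h : (ZMod 2)[X]) * initVec hd g i) / laurentOfPoly f)) m⟩)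
    (fun h i => fracPart_eq_digitNat m _)
  refine herr.trans ?_
  have hfig : (∑ u ∈ (Finset.univ : Finset (Finset (Fin d))).filter (fun u => u.Nonempty),
      initWeights hd γ u * (∏ i ∈ u, (initVec hd b i - initVec hd a i)) *
        walshSum m (polyLattice m (initVec hd g) f) u) ≤
      (1 / 2 ^ m : ℝ) * ∑ u ∈ (Finset.univ : Finset (Finset (Fin d))).filter (fun u => u.Nonempty),
        initWeights hd γ u * (∏ i ∈ u, (initVec hd b i - initVec hd a i)) *
          ((m : ℝ) / 2) ^ u.card := by
    refine (figureOfMerit_initVec hd a b γ g f).trans_le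
      ((hg.sum_walshSum_le hab hγ hf hm hd1 hd).trans (le_of_eq ?_))
    rw [← sum_nonempty_map_castLEEmb hd]
    congr 1
    refine Finset.sum_congr rfl fun u _ => ?_
    rw [Finset.prod_map, Finset.card_map]
    rfl
  -- The discretization error involves singletons only, with factor 1; the term `2 ^ u.card` over
  -- all nonempty `u` is a generous upper bound.
  have hsingle : ∑ i, initWeights hd γ {i} * (initVec hd b i - initVec hd a i) ≤
      ∑ u ∈ (Finset.univ : Finset (Finset (Fin d))).filter (fun u => u.Nonempty),
        initWeights hd γ u * (∏ i ∈ u, (initVec hd b i - initVec hd a i)) * (2 : ℝ) ^ u.card := by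
    have hnonneg : ∀ u : Finset (Fin d), 0 ≤ initWeights hd γ u *
        ∏ i ∈ u, (initVec hd b i - initVec hd a i) := fun u =>
      mul_nonneg (hγ' u).le (Finset.prod_nonneg fun i _ => sub_nonneg.2 (hab' i).le)
    calc _ ≤ ∑ u ∈ Finset.univ.map ⟨fun i : Fin d => ({i} : Finset (Fin d)),
            Finset.singleton_injective⟩, initWeights hd γ u *
              (∏ i ∈ u, (initVec hd b i - initVec hd a i)) * (2 : ℝ) ^ u.card := by
          rw [Finset.sum_map]
          refine Finset.sum_le_sum fun i _ => ?_
          have := hnonneg {i}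
          simp only [Function.Embedding.coeFn_mk, Finset.prod_singleton, Finset.card_singleton,
            pow_one] at this ⊢
          linarith
      _ ≤ _ := by
          refine Finset.sum_le_sum_of_subset_of_nonneg (fun u hu => ?_) fun u _ _ =>
            mul_nonneg (hnonneg u) (by positivity)
          obtain ⟨i, _, rfl⟩ := Finset.mem_map.1 hu
          simp
  refine (add_le_add hfig (mul_le_mul_of_nonneg_left hsingle (by positivity))).trans
    (le_of_eq ?_)
  rw [← mul_add, ← Finset.sum_add_distrib]
  congr 1
  exact Finset.sum_congr rfl fun u _ => by ring
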